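/- **Setting.** For $k\ge 1$ let $D_k$ be the $2^k\times 2^k$ matrix whose rows are indexed by the assignments $x\in\{\pm1\}^k$, whose columns are indexed by the multilinear monomials in $x_1,\dots,x_k$, and whose entries are the evaluations. Adding up the columns belonging to the monomials of each elementary symmetric polynomial $p_0,\dots,p_k$, and keeping one row for each class of assignments under permutations of the variables (class $i$ consists of the $\binom ki$ assignments with exactly $i$ entries $-1$), gives the $(k+1)\times(k+1)$ matrix $\tilde D_k$. Let $L=\mathrm{diag}\big(\sqrt{\tbinom ki}\big)_{0\le i\le k}$, and let $R$ be the diagonal matrix with positive entries that normalizes the columns of $L\tilde D_k$. The *squashed QFT* is $V_k=L\cdot\tilde D_k\cdot R$. For $y\in\mathbb Z$ let $c_k(y)=\binom{k}{(k+y)/2}$ if $-k\le y\le k$ and $y\equiv k \pmod 2$, and $c_k(y)=0$ otherwise. $\mathcal B(0,k)$ is the distribution with $\Pr[y]=c_k(y)/2^k$. A polynomial $Q$ in $n$ variables with $m\geq 1$ monomials is *specified* by a one-to-one function $h:[m]\to\{0,1\}^n$ if $Q=\sum_{z\in[m]}X_1^{h(z)_1}\cdots X_n^{h(z)_n}$.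 It is assumed to be homogeneous of degree $d\ge1$. Put $\mathrm{Var}=\mathrm{Var}[Q(X_1,\dots,X_n)]$ with $X_1,\dots,X_n$ independent and $\mathcal B(0,k)$-distributed. The *squashed distribution* is $$\Pr[y]=\frac{Q(y)^2\prod_{i=1}^n c_k(y_i)}{2^{kn}\,\mathrm{Var}},\qquad y\in[-k,k]^n$$ (and $\Pr[y]=0$ for all other $y\in\mathbb Z^n$). A *quantum circuit* is a product of unitaries on qubits, each acting on at most $b$ of the qubits, where $b$ is a constant; its running time is the number of factors. A qudit of dimension $k+1$ is written in binary on the least number of qubits that suffices, and circuits may use ancilla qubits that start and end in state $0$. **Theorem.** Let $(Q_i,h_i,n_i,m_i,d_i,k_i)_{i\in I}$ be any family of such data: $Q_i$ is homogeneous of degree $d_i\ge1$ in $n_i$ variables, has $m_i\ge1$ monomials and is specified by $h_i$, and $k_i\ge1$. 1. Each $V_{k_i}$ is unitary. 2. For each $i$, write $n=n_i$, $m=m_i$, $k=k_i$, $h=h_i$. If $V_k^{\otimes n}$ is applied to the state $\frac1{\sqrt m}\sum_{z\in[m]}|h(z)\rangle$ of $n$ qudits of dimension $k+1$, then for every $r\in\{0,\dots,k\}^n$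 the squared modulus of the amplitude of $|r\rangle$ is the squashed probability of $y=(k-2r_1,\dots,k-2r_n)$. 3. Suppose that - $h_i$ and its inverse on its image are efficiently computable (by Boolean circuits of size polynomial in $n_i$), - $k_i\le 2^{p(n_i)}$ for some polynomial $p$, and - $V_{k_i}$ is implemented by quantum circuits with a number of gates and of ancilla qubits polynomial in $n_i$. Then the squashed distributions can be sampled exactly and efficiently on a quantum computer, as follows. With a constant locality bound, and with numbers of gates and of ancilla qubits polynomial in $n_i$, there are a quantum circuit $P_i$ that prepares the state in 2 from the all-zero state and a quantum circuit $W_i$ that implements $V_{k_i}^{\otimes n_i}$. Applying $P_i$, then $W_i$, to the all-zero state, measuring all qubits in the standard basis and reading the number $r_j$ in the $j$-th register as $y_j=k_i-2r_j$ gives every $y\in\mathbb Z^{n_i}$ with exactly its squashed probability. -/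

import Mathlib

open scoped Matrix

/-! ### The squashed quantum Fourier transform -/

section SquashedQFT

/-- The `2^k × 2^k` matrix `D_k`: rows are the assignments in `{±1}^k` (here `ℤˣ = {1, -1}`),
columns are the multilinear monomials (subsets of the variables), entries are evaluations. -/
def monomialMatrix (k : ℕ) : Matrix (Fin k → ℤˣ) (Finset (Fin k)) ℝ :=
  Matrix.of fun x S => ∏ l ∈ S, ((x l : ℤ) : ℝ)

/-- The `2^k × (k+1)` matrix whose `j`-th column is the sum of the columns of `D_k` belonging to the
monomials of the `j`-th elementary symmetric polynomial. -/
noncomputable def symmetrizedColumns (k : ℕ) : Matrix (Fin k → ℤˣ) (Fin (k + 1)) ℝ :=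
  Matrix.of fun x j => ∑ S ∈ Finset.powersetCard (j : ℕ) Finset.univ, monomialMatrix k x S

/-- The `i`-th class of assignments under permutations of the variables:
those with exactly `i` entries equal to `-1`. -/
def assignmentClass (k i : ℕ) : Finset (Fin k → ℤˣ) :=
  Finset.univ.filter fun x => (Finset.univ.filter fun l => x l = -1).card = i

/-- A representative of the `i`-th class (`i ≤ k`): the first `i` entries are `-1`, the others `1`. -/
def classRepresentative (k i : ℕ) : Fin k → ℤˣ :=
  fun l => if (l : ℕ) < i then -1 else 1

/-- The `(k+1) × (k+1)` matrix `D̃_k`: one row is kept from each class of assignments. -/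
noncomputable def squashedMatrix (k : ℕ) : Matrix (Fin (k + 1)) (Fin (k + 1)) ℝ :=
  Matrix.of fun i j => symmetrizedColumns k (classRepresentative k i) j

/-- The diagonal matrix `L`, with `i`-th entry the square root of the size of the `i`-th class. -/
noncomputable def squashL (k : ℕ) : Matrix (Fin (k + 1)) (Fin (k + 1)) ℝ :=
  Matrix.diagonal fun i => Real.sqrt ((assignmentClass k i).card : ℝ)

/-- The diagonal matrix `R` that normalizes the columns of `L D̃_k`. -/
noncomputable def squashR (k : ℕ) : Matrix (Fin (k + 1)) (Fin (k + 1)) ℝ :=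
  Matrix.diagonal fun j => (Real.sqrt (∑ i, ((squashL k * squashedMatrix k) i j) ^ 2))⁻¹

/-- The squashed quantum Fourier transform `L D̃_k R`, as a complex matrix. -/
noncomputable def squashedQFT (k : ℕ) : Matrix (Fin (k + 1)) (Fin (k + 1)) ℂ :=
  (squashL k * squashedMatrix k * squashR k).map Complex.ofReal

/-- The `n`-fold tensor power of a matrix, acting on `n` qudits. -/
def tensorPower {κ : Type*} (n : ℕ) (V : Matrix κ κ ℂ) : Matrix (Fin n → κ) (Fin n → κ) ℂ :=
  Matrix.of fun r s => ∏ i, V (r i) (s i)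

end SquashedQFT

/-! ### The polynomial, the binomial distribution and the squashed distribution -/

section Distribution

/-- The number of assignments in `{±1}^k` with coordinate sum `y`: the binomial coefficient
`C(k, (k+y)/2)` if `y ∈ [-k,k]` has the parity of `k`, and `0` otherwise. -/
def orbitSize (k : ℕ) (y : ℤ) : ℕ :=
  if -(k : ℤ) ≤ y ∧ y ≤ k ∧ (2 : ℤ) ∣ k + y then k.choose (((k : ℤ) + y) / 2).toNat else 0

/-- The distribution `B(0,k)`, as a measure on `ℝ`. -/
noncomputable def centeredBinomial (k : ℕ) : MeasureTheory.Measure ℝ :=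
  ∑ y ∈ Finset.Icc (-(k : ℤ)) k,
    ENNReal.ofReal ((orbitSize k y : ℝ) / 2 ^ k) • MeasureTheory.Measure.dirac (y : ℝ)

/-- The variance of `Q(X₁, …, X_n)` for independent `X_i` with distribution `B(0,k)`. -/
noncomputable def polynomialVariance {n : ℕ} (k : ℕ) (Q : MvPolynomial (Fin n) ℝ) : ℝ :=
  ProbabilityTheory.variance (fun x : Fin n → ℝ => MvPolynomial.eval x Q)
    (MeasureTheory.Measure.pi fun _ : Fin n => centeredBinomial k)

/-- The squashed distribution: the probability of `y`. -/
noncomputable def squashedProb {n : ℕ} (k : ℕ) (Q : MvPolynomial (Fin n) ℝ) (y : Fin n → ℤ) : ℝ :=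
  MvPolynomial.eval (fun i => (y i : ℝ)) Q ^ 2 * (∏ i, (orbitSize k (y i) : ℝ)) /
    (2 ^ (k * n) * polynomialVariance k Q)

/-- `Q` is the sum of the `m` distinct multilinear monomials with exponent vectors `h(z)`. -/
def IsSpecifiedBy {n m : ℕ} (Q : MvPolynomial (Fin n) ℝ) (h : Fin m → Fin n → Bool) : Prop :=
  Function.Injective h ∧ Q = ∑ z, ∏ i, MvPolynomial.X i ^ (h z i).toNat

/-- The state `m^{-1/2} ∑_z |h(z)⟩` of `n` qudits of dimension `k + 1`; the bits `0`, `1` of `h(z)`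
are the basis states `|0⟩`, `|1⟩`. -/
noncomputable def monomialState {n m : ℕ} (k : ℕ) (h : Fin m → Fin n → Bool) :
    (Fin n → Fin (k + 1)) → ℂ :=
  fun r => (((Real.sqrt m)⁻¹ : ℝ) : ℂ) *
    ∑ z, if ∀ i, (r i : ℕ) = (h z i).toNat then 1 else 0

end Distribution

/-! ### Boolean circuits -/

section BooleanCircuits

/-- A straight-line program of NAND gates with `a` inputs and `b` outputs. Wires `0, …, a-1` carry
the input; the `s`-th gate `(i, j)` puts the NAND of wires `i` and `j` on wire `a + s`. -/
structure BoolCircuit (a b : ℕ) where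
  gates : List (ℕ × ℕ)
  output : Fin b → ℕ

/-- The number of gates. -/
def BoolCircuit.size {a b : ℕ} (C : BoolCircuit a b) : ℕ := C.gates.length

/-- The function computed by a circuit (a wire that has not been written carries `false`). -/
def BoolCircuit.eval {a b : ℕ} (C : BoolCircuit a b) (x : Fin a → Bool) : Fin b → Bool :=
  fun o =>
    (C.gates.foldl (fun wires g =>
        wires ++ [!(wires.getD g.1 false && wires.getD g.2 false)]) (List.ofFn x)).getD
      (C.output o) false

/-- The `t` low-order binary digits of `j`. -/
def binary (t j : ℕ) : Fin t → Bool := fun q => j.testBit q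

/-- The functions `h_i : [m_i] → {0,1}^{n_i}` and their inverses on their images are computed by
Boolean circuits of size polynomial in `n_i`. An index `z ∈ [m_i]` is written with `n_i` binary digits
(`m_i ≤ 2^{n_i}` since `h_i` is one-to-one). -/
def EfficientlyInvertible {I : Type*} (n m : I → ℕ) (h : ∀ i, Fin (m i) → Fin (n i) → Bool) : Prop :=
  ∃ p : Polynomial ℕ, ∀ i, ∃ C C' : BoolCircuit (n i) (n i),
    C.size ≤ p.eval (n i) ∧ C'.size ≤ p.eval (n i) ∧
    (∀ z : Fin (m i), C.eval (binary (n i) z) = h i z) ∧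
    (∀ z : Fin (m i), C'.eval (h i z) = binary (n i) z)

end BooleanCircuits

/-! ### Quantum circuits -/

section QuantumCircuits

variable {ι : Type*} [Fintype ι] [DecidableEq ι]

/-- A standard basis vector of the space of qubits labelled by `ι`. -/
def ket (x : ι → Bool) : (ι → Bool) → ℂ := Pi.single x 1

open Classical in
/-- A local unitary: a unitary on at most `b` of the qubits, tensored with the identity. -/
def IsLocalUnitary (b : ℕ) (A : Matrix (ι → Bool) (ι → Bool) ℂ) : Prop :=
  ∃ c ≤ b, ∃ e : Fin c ↪ ι, ∃ U ∈ Matrix.unitaryGroup (Fin c → Bool) ℂ,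
    A = Matrix.of fun x y =>
      if ∀ q, q ∉ Set.range e → x q = y q then U (x ∘ e) (y ∘ e) else 0

/-- `A` is a product of at most `s` unitaries, each of which acts on at most `b` qubits. -/
def HasLocalDecomposition (b s : ℕ) (A : Matrix (ι → Bool) (ι → Bool) ℂ) : Prop :=
  ∃ l : List (Matrix (ι → Bool) (ι → Bool) ℂ),
    l.length ≤ s ∧ (∀ B ∈ l, IsLocalUnitary b B) ∧ l.prod = A

/-- `A` acts as `V` on the basis states `|E j⟩` that encode the logical basis states `j`. -/
def Implements {κ : Type*} [Fintype κ] (E : κ → ι → Bool) (V : Matrix κ κ ℂ)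
    (A : Matrix (ι → Bool) (ι → Bool) ℂ) : Prop :=
  ∀ j, A *ᵥ ket (E j) = ∑ i, V i j • ket (E i)

/-- A basis state of one `(k+1)`-dimensional qudit, written in binary on `Nat.size k` qubits (the
least number `t` with `k < 2^t`) next to `a` ancilla qubits in state `0`. -/
def encodeQudit (k a : ℕ) (j : Fin (k + 1)) : Fin k.size ⊕ Fin a → Bool :=
  Sum.elim (binary k.size j) (fun _ => false)

/-- A basis state of `n` qudits of dimension `k+1`, each written in binary on its own `Nat.size k`
qubits, next to `a` ancilla qubits in state `0`. -/
def encodeQudits (n k a : ℕ) (r : Fin n → Fin (k + 1)) : (Fin n × Fin k.size) ⊕ Fin a → Bool :=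
  Sum.elim (fun q => binary k.size (r q.1) q.2) (fun _ => false)

/-- The squashed transforms of sizes `k_i + 1` have quantum circuits with polynomially many (in `n_i`)
local gates, using polynomially many ancilla qubits, which are returned to `0`. -/
def SquashedQFTEfficient {I : Type*} (n k : I → ℕ) : Prop :=
  ∃ (b : ℕ) (p : Polynomial ℕ), ∀ i, ∃ a ≤ p.eval (n i),
    ∃ A : Matrix (Fin (k i).size ⊕ Fin a → Bool) (Fin (k i).size ⊕ Fin a → Bool) ℂ,
      HasLocalDecomposition b (p.eval (n i)) A ∧
      Implements (encodeQudit (k i) a) (squashedQFT (k i)) A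

/-- The point of `ℤⁿ` named by a measured bit string: if the `i`-th register holds the number `c`, the
index of the class of assignments with `c` entries `-1`, then the `i`-th coordinate is the
coordinate sum `k - 2c` of such an assignment. -/
def outcome (n k a : ℕ) (x : (Fin n × Fin k.size) ⊕ Fin a → Bool) : Fin n → ℤ :=
  fun i => (k : ℤ) - 2 * (Nat.ofBits fun q : Fin k.size => x (Sum.inl (i, q)) : ℕ)

/-- The probability of obtaining `y` when all qubits are measured in the standard basis after `A` has
been applied to the all-zero state. -/
noncomputable def outcomeProb (n k a : ℕ)
    (A : Matrix ((Fin n × Fin k.size) ⊕ Fin a → Bool) ((Fin n × Fin k.size) ⊕ Fin a → Bool) ℂ)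
    (y : Fin n → ℤ) : ℝ :=
  ∑ x ∈ Finset.univ.filter (fun x => outcome n k a x = y), ‖(A *ᵥ ket (fun _ => false)) x‖ ^ 2

end QuantumCircuits

/-! ### Unitarity of the squashed transform -/

/-! The columns of `D_k` are the characters of the group of sign vectors, hence pairwise orthogonal
with squared norm `2^k`. Adding up disjoint groups of columns keeps orthogonality. The resulting
entries are symmetric in the signs, so they are constant on each class, and replacing the `C(k,i)`
equal rows of class `i` by one row times `√C(k,i)` preserves all inner products of columns.
Normalizing the columns then gives a unitary (`sum_choose_mul_squashedMatrix_mul`).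

The monomial state only meets columns `0` and `1` of `V_k`, which come from `p_0 = 1` and `p_1 = k -
2r`. With `y = k - 2r` their entries are `√(C(k,r)/2^k)` times `1` or `y/√k`. Tensoring sends
`|h(z)⟩` to the root of the binomial weight, times the `z`-th monomial at `y`, times `k^(-d/2)`; the
last factor is common to all `z` by homogeneity, so the sum over `z` produces `Q(y)`. The remaining
constant `m * k^d` is the variance: the same orthogonality, read as moments of `B(0,k)`, makes
distinct multilinear monomials orthogonal with second moment `k^d`, and of mean zero because `d ≥ 1`
(`polynomialVariance_eq`, `norm_sq_amplitude`).

For the circuits, `V_k` is applied to one register after another with shared ancillas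
(`exists_implements_tensorPower`). The state is prepared by making an exact uniform superposition of
the indices `z < m`, digit by digit from the top, with one flag qubit for the comparison with `m -
1` (`exists_uniform_superposition`); then `h(z)` is computed reversibly next to `z`, and the circuit
for the inverse of `h` erases `z` (`exists_preparation`). -/

theorem sum_prod_eq_prod_sum {ι κ : Type*} [Fintype ι] [DecidableEq ι] [Fintype κ]
    {R : Type*} [CommSemiring R] (g : ι → κ → R) :
    ∑ x : ι → κ, ∏ i, g i (x i) = ∏ i, ∑ u, g i u := by
  rw [Finset.prod_univ_sum, Fintype.piFinset_univ]

/-- The sum over sign vectors factors over the coordinates: one that lies in exactly one of `S`, `T`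
contributes `1 + (-1) = 0`, any other contributes `2`. -/
theorem sum_monomial_mul_monomial (k : ℕ) (S T : Finset (Fin k)) :
    ∑ x, monomialMatrix k x S * monomialMatrix k x T = if S = T then 2 ^ k else 0 := by
  have key : ∀ x : Fin k → ℤˣ, monomialMatrix k x S * monomialMatrix k x T =
      ∏ l, ((if l ∈ S then ((x l : ℤ) : ℝ) else 1) * (if l ∈ T then ((x l : ℤ) : ℝ) else 1)) := by
    intro x
    rw [Finset.prod_mul_distrib, Finset.prod_ite_mem, Finset.prod_ite_mem, Finset.univ_inter,
      Finset.univ_inter]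
    rfl
  simp_rw [key]
  rw [sum_prod_eq_prod_sum (fun l (u : ℤˣ) => (if l ∈ S then ((u : ℤ) : ℝ) else 1) *
    (if l ∈ T then ((u : ℤ) : ℝ) else 1))]
  have factor : ∀ l, ∑ u : ℤˣ, ((if l ∈ S then ((u : ℤ) : ℝ) else 1) *
      (if l ∈ T then ((u : ℤ) : ℝ) else 1)) = if (l ∈ S ↔ l ∈ T) then 2 else 0 := by
    intro l
    rw [UnitsInt.univ, Finset.sum_pair (by decide)]
    by_cases h1 : l ∈ S <;> by_cases h2 : l ∈ T <;> simp [h1, h2] <;> norm_num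
  simp_rw [factor]
  split_ifs with h
  · simp [h]
  · obtain ⟨l, hl⟩ : ∃ l, ¬(l ∈ S ↔ l ∈ T) := by
      by_contra! hc
      exact h (Finset.ext hc)
    exact Finset.prod_eq_zero (Finset.mem_univ l) (by simp [hl])

/-- Different elementary symmetric polynomials share no monomial; for `j = l` each of the `C(k,j)`
monomials contributes `2^k`. -/
theorem sum_symmetrizedColumns_mul (k : ℕ) (j l : Fin (k + 1)) :
    ∑ x, symmetrizedColumns k x j * symmetrizedColumns k x l =
      if j = l then 2 ^ k * (k.choose j : ℝ) else 0 := by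
  simp only [symmetrizedColumns, Matrix.of_apply, Finset.sum_mul_sum]
  rw [Finset.sum_comm]
  simp_rw [Finset.sum_comm (s := Finset.univ), sum_monomial_mul_monomial, Finset.sum_ite_eq]
  split_ifs with h
  · subst h
    rw [Finset.sum_congr rfl fun S hS => if_pos hS]
    simp [mul_comm]
  · refine Finset.sum_eq_zero fun S hS => if_neg fun hS' => h ?_
    rw [Finset.mem_powersetCard] at hS hS'
    exact Fin.ext (hS.2.symm.trans hS'.2)

/-- The number of entries `-1` of an assignment. -/
def minusCount {k : ℕ} (x : Fin k → ℤˣ) : ℕ := (Finset.univ.filter fun l => x l = -1).card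

theorem minusCount_le {k : ℕ} (x : Fin k → ℤˣ) : minusCount x ≤ k := by
  simpa [minusCount] using Finset.card_filter_le Finset.univ fun l => x l = -1

theorem minusCount_classRepresentative {k i : ℕ} (hi : i ≤ k) :
    minusCount (classRepresentative k i) = i := by
  have : (Finset.univ.filter fun l : Fin k => classRepresentative k i l = -1) =
      Finset.univ.filter fun l : Fin k => (l : ℕ) < i := by
    refine Finset.filter_congr fun l _ => ?_
    unfold classRepresentative
    split_ifs with h <;> simp [h]
  rw [minusCount, this, Fin.card_filter_val_lt, min_eq_right hi]

/-- A multiset of `k` signs is determined by the multiplicity of `-1`. This makes the choice of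
class representatives immaterial. -/
theorem map_eq_of_minusCount_eq {k : ℕ} {x y : Fin k → ℤˣ} (h : minusCount x = minusCount y) :
    (Finset.univ : Finset (Fin k)).val.map x = (Finset.univ : Finset (Fin k)).val.map y := by
  have count_minus : ∀ z : Fin k → ℤˣ,
      ((Finset.univ : Finset (Fin k)).val.map z).count (-1) = minusCount z := by
    intro z
    rw [Multiset.count_map, minusCount, Finset.card, Finset.filter_val]
    simp_rw [eq_comm]
  have count_plus : ∀ z : Fin k → ℤˣ,
      ((Finset.univ : Finset (Fin k)).val.map z).count 1 + minusCount z = k := by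
    intro z
    have h1 := Finset.card_filter_add_card_filter_not (s := (Finset.univ : Finset (Fin k)))
      (fun l => z l = -1)
    have h2 : (Finset.univ.filter fun l => ¬ z l = -1) = Finset.univ.filter fun l => 1 = z l := by
      refine Finset.filter_congr fun l _ => ?_
      rcases Int.units_eq_one_or (z l) with h | h <;> rw [h] <;> decide
    rw [h2, Finset.card_univ, Fintype.card_fin] at h1
    rw [Multiset.count_map, ← Finset.filter_val]
    change (Finset.univ.filter fun l => 1 = z l).card + _ = k
    unfold minusCount
    omega
  ext u
  rcases Int.units_eq_one_or u with rfl | rfl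
  · have := count_plus x
    have := count_plus y
    omega
  · rw [count_minus, count_minus, h]

theorem symmetrizedColumns_eq_esymm {k : ℕ} (x : Fin k → ℤˣ) (j : Fin (k + 1)) :
    symmetrizedColumns k x j =
      (((Finset.univ : Finset (Fin k)).val.map x).map fun u : ℤˣ => ((u : ℤ) : ℝ)).esymm j := by
  rw [Multiset.map_map, Finset.esymm_map_val]
  rfl

theorem symmetrizedColumns_eq_squashedMatrix {k : ℕ} {x : Fin k → ℤˣ} {i : Fin (k + 1)}
    (h : minusCount x = i) (j : Fin (k + 1)) :
    symmetrizedColumns k x j = squashedMatrix k i j := by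
  rw [squashedMatrix, Matrix.of_apply, symmetrizedColumns_eq_esymm, symmetrizedColumns_eq_esymm,
    map_eq_of_minusCount_eq (h.trans (minusCount_classRepresentative i.is_le).symm)]

theorem card_assignmentClass (k i : ℕ) : (assignmentClass k i).card = k.choose i := by
  have hbij : (assignmentClass k i).card =
      (Finset.powersetCard i (Finset.univ : Finset (Fin k))).card := by
    refine Finset.card_bij' (fun x _ => Finset.univ.filter fun l => x l = -1)
      (fun S _ l => if l ∈ S then -1 else 1) ?_ ?_ ?_ ?_
    · intro x hx
      simpa [assignmentClass, Finset.mem_powersetCard] using hx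
    · intro S hS
      rw [Finset.mem_powersetCard] at hS
      have : ∀ l, ((if l ∈ S then -1 else 1 : ℤˣ) = -1) ↔ l ∈ S := by
        intro l
        split_ifs with h <;> simp [h]
      simp [assignmentClass, this, hS.2]
    · intro x _
      funext l
      rcases Int.units_eq_one_or (x l) with h | h <;> simp [h]
    · intro S _
      ext l
      by_cases h : l ∈ S <;> simp [h]
  rw [hbij, Finset.card_powersetCard, Finset.card_univ, Fintype.card_fin]

/-- Column orthogonality over all sign vectors, grouped by class: `C(k,i)` counts equal summands.
Both the unitarity and the moments of `B(0,k)` come from this identity. -/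
theorem sum_choose_mul_squashedMatrix_mul (k : ℕ) (j l : Fin (k + 1)) :
    ∑ i : Fin (k + 1), (k.choose i : ℝ) * (squashedMatrix k i j * squashedMatrix k i l) =
      if j = l then 2 ^ k * (k.choose j : ℝ) else 0 := by
  rw [← sum_symmetrizedColumns_mul, ← Finset.sum_fiberwise (s := Finset.univ)
    (g := fun x : Fin k → ℤˣ => (⟨minusCount x, Nat.lt_succ_of_le (minusCount_le x)⟩ : Fin (k + 1)))]
  refine Finset.sum_congr rfl fun i _ => ?_
  have hset : (Finset.univ.filter fun x : Fin k → ℤˣ =>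
      (⟨minusCount x, Nat.lt_succ_of_le (minusCount_le x)⟩ : Fin (k + 1)) = i) =
      assignmentClass k i := by
    ext x
    simp [assignmentClass, Fin.ext_iff, minusCount]
  rw [hset, Finset.sum_congr rfl fun x hx => by
    have hx' : minusCount x = i := by simpa [assignmentClass, minusCount] using hx
    rw [symmetrizedColumns_eq_squashedMatrix hx', symmetrizedColumns_eq_squashedMatrix hx'],
    Finset.sum_const, card_assignmentClass, nsmul_eq_mul]

theorem squashL_mul_squashedMatrix_apply (k : ℕ) (i j : Fin (k + 1)) :
    (squashL k * squashedMatrix k) i j = Real.sqrt (k.choose i) * squashedMatrix k i j := by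
  rw [squashL, Matrix.diagonal_mul, card_assignmentClass]

theorem squashR_eq (k : ℕ) :
    squashR k = Matrix.diagonal fun j : Fin (k + 1) => (Real.sqrt (2 ^ k * (k.choose j : ℝ)))⁻¹ := by
  unfold squashR
  congr 1
  funext j
  congr 2
  have := sum_choose_mul_squashedMatrix_mul k j j
  rw [if_pos rfl] at this
  rw [← this]
  refine Finset.sum_congr rfl fun i _ => ?_
  rw [squashL_mul_squashedMatrix_apply, mul_pow, Real.sq_sqrt (Nat.cast_nonneg _), sq]

/-- The entries of the squashed transform, before the coercion to `ℂ`. -/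
noncomputable def squashedEntry (k : ℕ) (i j : Fin (k + 1)) : ℝ :=
  Real.sqrt (k.choose i) * squashedMatrix k i j * (Real.sqrt (2 ^ k * (k.choose j : ℝ)))⁻¹

theorem squashedQFT_apply (k : ℕ) (i j : Fin (k + 1)) :
    squashedQFT k i j = (squashedEntry k i j : ℂ) := by
  rw [squashedQFT, Matrix.map_apply, squashR_eq, Matrix.mul_diagonal,
    squashL_mul_squashedMatrix_apply, squashedEntry]

theorem sum_squashedEntry_mul (k : ℕ) (j l : Fin (k + 1)) :
    ∑ i, squashedEntry k i j * squashedEntry k i l = if j = l then 1 else 0 := by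
  have hpos : (0 : ℝ) < 2 ^ k * (k.choose j : ℝ) :=
    mul_pos (by positivity) (by exact_mod_cast Nat.choose_pos j.is_le)
  have : ∀ i, squashedEntry k i j * squashedEntry k i l =
      ((k.choose i : ℝ) * (squashedMatrix k i j * squashedMatrix k i l)) *
      ((Real.sqrt (2 ^ k * (k.choose j : ℝ)))⁻¹ * (Real.sqrt (2 ^ k * (k.choose l : ℝ)))⁻¹) := by
    intro i
    have hs := Real.mul_self_sqrt (Nat.cast_nonneg (α := ℝ) (k.choose i))
    unfold squashedEntry
    linear_combination (squashedMatrix k i j * squashedMatrix k i l *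
      ((Real.sqrt (2 ^ k * (k.choose j : ℝ)))⁻¹ * (Real.sqrt (2 ^ k * (k.choose l : ℝ)))⁻¹)) * hs
  simp_rw [this, ← Finset.sum_mul, sum_choose_mul_squashedMatrix_mul]
  split_ifs with h
  · subst h
    rw [← mul_inv, Real.mul_self_sqrt hpos.le, mul_inv_cancel₀ hpos.ne']
  · simp

theorem squashedQFT_mem_unitaryGroup (k : ℕ) :
    squashedQFT k ∈ Matrix.unitaryGroup (Fin (k + 1)) ℂ := by
  rw [Matrix.mem_unitaryGroup_iff']
  ext j l
  rw [Matrix.star_eq_conjTranspose, Matrix.mul_apply, Matrix.one_apply]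
  simp_rw [Matrix.conjTranspose_apply, squashedQFT_apply, RCLike.star_def, Complex.conj_ofReal,
    ← Complex.ofReal_mul, ← Complex.ofReal_sum, sum_squashedEntry_mul]
  split_ifs <;> simp

/-! ### The columns of degree 0 and 1 -/

theorem squashedMatrix_zero (k : ℕ) (i : Fin (k + 1)) : squashedMatrix k i 0 = 1 := by
  simp [squashedMatrix, symmetrizedColumns, monomialMatrix]

theorem squashedMatrix_one {k : ℕ} (hk : 0 < k) (i : Fin (k + 1)) :
    squashedMatrix k i ⟨1, Nat.succ_lt_succ hk⟩ = (k : ℝ) - 2 * (i : ℕ) := by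
  have h1 : squashedMatrix k i ⟨1, Nat.succ_lt_succ hk⟩ =
      ∑ l : Fin k, ((classRepresentative k i l : ℤ) : ℝ) := by
    simp [squashedMatrix, symmetrizedColumns, monomialMatrix, Finset.powersetCard_one]
  have h2 : ∀ l : Fin k, ((classRepresentative k i l : ℤ) : ℝ) =
      1 - 2 * (if classRepresentative k i l = -1 then 1 else 0) := by
    intro l
    rcases Int.units_eq_one_or (classRepresentative k i l) with h | h <;> rw [h]
    · rw [if_neg (by decide)]; simp
    · rw [if_pos rfl]; norm_num
  have h3 := minusCount_classRepresentative i.is_le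
  rw [h1, Finset.sum_congr rfl fun l _ => h2 l, Finset.sum_sub_distrib, ← Finset.mul_sum,
    Finset.sum_boole]
  unfold minusCount at h3
  rw [h3]
  simp

/-! ### Moments of the centered binomial distribution -/

theorem orbitSize_sub_two_mul {k r : ℕ} (hr : r ≤ k) :
    orbitSize k ((k : ℤ) - 2 * r) = k.choose r := by
  -- `(k + y) / 2` is the number of entries `+1`, here `k - r`.
  rw [orbitSize, if_pos ⟨by omega, by omega, by omega⟩,
    show (((k : ℤ) + (k - 2 * r)) / 2).toNat = k - r by omega,
    Nat.choose_symm hr]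

theorem exists_of_orbitSize_ne_zero {k : ℕ} {y : ℤ} (hy : orbitSize k y ≠ 0) :
    ∃ r : Fin (k + 1), (k : ℤ) - 2 * (r : ℕ) = y := by
  unfold orbitSize at hy
  split_ifs at hy with h
  · obtain ⟨h1, h2, c, hc⟩ := h
    exact ⟨⟨((k - y) / 2).toNat, by omega⟩, by simp only; omega⟩
  · exact absurd rfl hy

theorem sum_Icc_orbitSize_mul (k : ℕ) (g : ℤ → ℝ) :
    ∑ y ∈ Finset.Icc (-(k : ℤ)) k, (orbitSize k y : ℝ) * g y =
      ∑ r : Fin (k + 1), (k.choose r : ℝ) * g (k - 2 * (r : ℕ)) := by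
  symm
  refine Finset.sum_of_injOn (fun r : Fin (k + 1) => (k : ℤ) - 2 * (r : ℕ)) ?_ ?_ ?_ ?_
  · intro r _ s _ h
    simp only at h
    exact Fin.ext (by omega)
  · intro r _
    have := r.is_le
    simp only [Finset.coe_Icc, Set.mem_Icc]
    omega
  · intro y _ hy
    by_contra hne
    obtain ⟨r, hr⟩ := exists_of_orbitSize_ne_zero (k := k) (y := y) fun h0 => hne (by simp [h0])
    exact hy ⟨r, by simp, hr⟩
  · intro r _
    simp only [orbitSize_sub_two_mul r.is_le]

theorem integrable_centeredBinomial (k : ℕ) (f : ℝ → ℝ) :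
    MeasureTheory.Integrable f (centeredBinomial k) := by
  unfold centeredBinomial
  rw [MeasureTheory.integrable_finsetSum_measure]
  intro y _
  exact (MeasureTheory.integrable_dirac (by simp)).smul_measure ENNReal.ofReal_ne_top

theorem integral_centeredBinomial (k : ℕ) (f : ℝ → ℝ) :
    ∫ x, f x ∂centeredBinomial k =
      (∑ r : Fin (k + 1), (k.choose r : ℝ) * f ((k : ℝ) - 2 * (r : ℕ))) / 2 ^ k := by
  have h := sum_Icc_orbitSize_mul k fun y => f y
  push_cast at h
  rw [← h, centeredBinomial, MeasureTheory.integral_finsetSum_measure, Finset.sum_div]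
  · refine Finset.sum_congr rfl fun y _ => ?_
    rw [MeasureTheory.integral_smul_measure, MeasureTheory.integral_dirac,
      ENNReal.toReal_ofReal (by positivity), smul_eq_mul]
    ring
  · intro y _
    exact (MeasureTheory.integrable_dirac (by simp)).smul_measure ENNReal.ofReal_ne_top

instance isFiniteMeasure_centeredBinomial (k : ℕ) :
    MeasureTheory.IsFiniteMeasure (centeredBinomial k) := by
  have := (MeasureTheory.integrable_const_iff (c := (1 : ℝ))).1
    (integrable_centeredBinomial k fun _ => 1)
  simpa using this

/-- Columns `0` and `1` of `D̃_k` list the powers `x^0` and `x^1` at the atoms `x = k - 2i`, so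
these moments are weighted column inner products divided by `2^k`. -/
theorem integral_pow_centeredBinomial {k : ℕ} (hk : 0 < k) (b c : Bool) :
    ∫ x, x ^ b.toNat * x ^ c.toNat ∂centeredBinomial k = if b = c then (k : ℝ) ^ b.toNat else 0 := by
  have hcol : ∀ (a : Bool) (i : Fin (k + 1)), squashedMatrix k i ⟨a.toNat, by cases a <;> simp [hk]⟩ =
      ((k : ℝ) - 2 * (i : ℕ)) ^ a.toNat := by
    intro a i
    cases a
    · simpa using squashedMatrix_zero k i
    · simpa using squashedMatrix_one hk i
  have h := sum_choose_mul_squashedMatrix_mul k ⟨b.toNat, by cases b <;> simp [hk]⟩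
    ⟨c.toNat, by cases c <;> simp [hk]⟩
  simp_rw [hcol] at h
  rw [integral_centeredBinomial k fun x => x ^ b.toNat * x ^ c.toNat, h]
  cases b <;> cases c <;> simp

/-! ### The variance of the polynomial -/

/-- Distinct exponent vectors cannot cancel, so each `h z` has a nonzero coefficient in `Q`, and
homogeneity fixes its weight. -/
theorem IsSpecifiedBy.sum_toNat_eq {n m d : ℕ} {Q : MvPolynomial (Fin n) ℝ}
    {h : Fin m → Fin n → Bool} (hQ : IsSpecifiedBy Q h) (hhom : Q.IsHomogeneous d) (z : Fin m) :
    ∑ i, (h z i).toNat = d := by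
  let e : Fin m → Fin n →₀ ℕ := fun z => Finsupp.equivFunOnFinite.symm fun i => (h z i).toNat
  have he : Function.Injective e := by
    intro z w hzw
    refine hQ.1 (funext fun i => ?_)
    have := DFunLike.congr_fun hzw i
    simp only [e, Finsupp.equivFunOnFinite_symm_apply_apply] at this
    revert this
    cases h z i <;> cases h w i <;> simp
  have hsum : Q = ∑ z, MvPolynomial.monomial (e z) 1 := by
    rw [hQ.2]
    refine Finset.sum_congr rfl fun z _ => ?_
    rw [MvPolynomial.monomial_eq, Finsupp.prod_fintype _ _ (by simp)]
    simp [e]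
  have hc : Q.coeff (e z) ≠ 0 := by
    rw [hsum, MvPolynomial.coeff_sum]
    simp [MvPolynomial.coeff_monomial, he.eq_iff]
  have := hhom hc
  rw [Finsupp.weight_apply, Finsupp.sum_fintype _ _ (by simp)] at this
  simpa [e] using this

theorem IsSpecifiedBy.eval_eq {n m : ℕ} {Q : MvPolynomial (Fin n) ℝ}
    {h : Fin m → Fin n → Bool} (hQ : IsSpecifiedBy Q h) (x : Fin n → ℝ) :
    MvPolynomial.eval x Q = ∑ z, ∏ i, x i ^ (h z i).toNat := by
  rw [hQ.2]
  simp

theorem integral_monomial_mul_monomial {n k : ℕ} (hk : 0 < k) (u v : Fin n → Bool) :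
    ∫ x : Fin n → ℝ, (∏ i, x i ^ (u i).toNat) * ∏ i, x i ^ (v i).toNat
      ∂(MeasureTheory.Measure.pi fun _ => centeredBinomial k) =
      if u = v then (k : ℝ) ^ ∑ i, (u i).toNat else 0 := by
  simp_rw [← Finset.prod_mul_distrib]
  rw [MeasureTheory.integral_fintype_prod_eq_prod (fun i x => x ^ (u i).toNat * x ^ (v i).toNat)]
  simp_rw [integral_pow_centeredBinomial hk]
  split_ifs with h
  · subst h
    simp [Finset.prod_pow_eq_pow_sum]
  · obtain ⟨i, hi⟩ := Function.ne_iff.1 h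
    exact Finset.prod_eq_zero (Finset.mem_univ i) (if_neg hi)

theorem integrable_monomial_mul_monomial {n k : ℕ} (u v : Fin n → Bool) :
    MeasureTheory.Integrable (fun x : Fin n → ℝ =>
        (∏ i, x i ^ (u i).toNat) * ∏ i, x i ^ (v i).toNat)
      (MeasureTheory.Measure.pi fun _ => centeredBinomial k) := by
  simp_rw [← Finset.prod_mul_distrib]
  exact MeasureTheory.Integrable.fintype_prod
    (f := fun i x => x ^ (u i).toNat * x ^ (v i).toNat) fun i => integrable_centeredBinomial k _

theorem polynomialVariance_eq {n m k d : ℕ} {Q : MvPolynomial (Fin n) ℝ}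
    {h : Fin m → Fin n → Bool} (hQ : IsSpecifiedBy Q h) (hhom : Q.IsHomogeneous d) (hd : 0 < d)
    (hk : 0 < k) : polynomialVariance k Q = m * (k : ℝ) ^ d := by
  have hdeg := hQ.sum_toNat_eq hhom
  have hmean : ∫ x, MvPolynomial.eval x Q
      ∂(MeasureTheory.Measure.pi fun _ : Fin n => centeredBinomial k) = 0 := by
    simp_rw [hQ.eval_eq]
    -- The mean of a monomial is its inner product with the constant monomial, whose exponent vector
    -- is all `false`; `d > 0` keeps the two distinct.
    have hint := fun z => integrable_monomial_mul_monomial (k := k) (h z) fun _ => false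
    have hval := fun z => integral_monomial_mul_monomial hk (h z) fun _ => false
    simp only [Bool.toNat_false, pow_zero, Finset.prod_const_one, mul_one] at hint hval
    rw [MeasureTheory.integral_finsetSum _ fun z _ => hint z]
    refine Finset.sum_eq_zero fun z _ => ?_
    rw [hval, if_neg]
    intro hz
    have := hdeg z
    simp [hz] at this
    omega
  rw [polynomialVariance, ProbabilityTheory.variance_of_integral_eq_zero
    (MvPolynomial.continuous_eval Q).measurable.aemeasurable hmean]
  simp_rw [hQ.eval_eq, sq, Finset.sum_mul_sum]
  rw [MeasureTheory.integral_finsetSum _ fun z _ => MeasureTheory.integrable_finsetSum _ fun w _ =>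
    integrable_monomial_mul_monomial (h z) (h w)]
  simp_rw [MeasureTheory.integral_finsetSum _ fun w _ => integrable_monomial_mul_monomial _ (h w),
    integral_monomial_mul_monomial hk, hQ.1.eq_iff, Finset.sum_ite_eq, Finset.mem_univ, if_true, hdeg]
  simp

/-! ### The amplitudes -/

/-- The basis state of a qudit that stands for a bit. -/
def bitLevel {k : ℕ} (hk : 0 < k) (b : Bool) : Fin (k + 1) := ⟨b.toNat, by cases b <;> simp [hk]⟩

theorem monomialState_eq {n m k : ℕ} (hk : 0 < k) (h : Fin m → Fin n → Bool) :
    monomialState k h = (((Real.sqrt m)⁻¹ : ℝ) : ℂ) •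
      ∑ z, Pi.single (fun i => bitLevel hk (h z i)) 1 := by
  funext r
  simp only [monomialState, Pi.smul_apply, Finset.sum_apply, Pi.single_apply, smul_eq_mul]
  simp [funext_iff, bitLevel, Fin.ext_iff]

/-- For `b` equal to `0` or `1`, `C(k,b) = k^b`, which turns the column normalization into a power
of `1/√k`. -/
theorem squashedEntry_bitLevel {k : ℕ} (hk : 0 < k) (r : Fin (k + 1)) (b : Bool) :
    squashedEntry k r (bitLevel hk b) =
      Real.sqrt (k.choose r / 2 ^ k) * (((k : ℝ) - 2 * (r : ℕ)) / Real.sqrt k) ^ b.toNat := by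
  rw [squashedEntry, Real.sqrt_div (Nat.cast_nonneg _)]
  cases b
  · have := squashedMatrix_zero k r
    simp only [bitLevel, Bool.toNat_false]
    simp [this, div_eq_mul_inv]
  · have := squashedMatrix_one hk r
    simp only [bitLevel, Bool.toNat_true]
    rw [this]
    simp only [Nat.choose_one_right, pow_one]
    rw [Real.sqrt_mul (by positivity)]
    field_simp

theorem tensorPower_mulVec_monomialState {n m k : ℕ} (hk : 0 < k) (h : Fin m → Fin n → Bool)
    (r : Fin n → Fin (k + 1)) :
    (tensorPower n (squashedQFT k) *ᵥ monomialState k h) r =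
      (((Real.sqrt m)⁻¹ * ((∏ i, Real.sqrt (k.choose (r i) / 2 ^ k)) *
        ∑ z, ∏ i, (((k : ℝ) - 2 * (r i : ℕ)) / Real.sqrt k) ^ (h z i).toNat) : ℝ) : ℂ) := by
  rw [monomialState_eq hk, Matrix.mulVec_smul, Matrix.mulVec_sum, Pi.smul_apply, Finset.sum_apply]
  simp_rw [Matrix.mulVec_single_one, Matrix.col_apply, tensorPower, Matrix.of_apply,
    squashedQFT_apply, squashedEntry_bitLevel, ← Complex.ofReal_prod, ← Complex.ofReal_sum,
    Finset.prod_mul_distrib, ← Finset.mul_sum]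
  rw [smul_eq_mul, ← Complex.ofReal_mul]

theorem norm_sq_amplitude {n m k d : ℕ} {Q : MvPolynomial (Fin n) ℝ}
    {h : Fin m → Fin n → Bool} (hQ : IsSpecifiedBy Q h) (hhom : Q.IsHomogeneous d) (hd : 0 < d)
    (hk : 0 < k) (r : Fin n → Fin (k + 1)) :
    ‖(tensorPower n (squashedQFT k) *ᵥ monomialState k h) r‖ ^ 2 =
      squashedProb k Q (fun j => (k : ℤ) - 2 * (r j : ℕ)) := by
  have hdeg := hQ.sum_toNat_eq hhom
  have hk' : (0 : ℝ) < k := by exact_mod_cast hk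
  rw [tensorPower_mulVec_monomialState hk, Complex.norm_real, Real.norm_eq_abs, sq_abs,
    squashedProb, polynomialVariance_eq hQ hhom hd hk, hQ.eval_eq]
  -- Homogeneity makes the factor `√k ^ d` the same for all monomials, so that it leaves the sum.
  have h1 : ∀ z, ∏ i, (((k : ℝ) - 2 * (r i : ℕ)) / Real.sqrt k) ^ (h z i).toNat =
      (∏ i, ((k : ℝ) - 2 * (r i : ℕ)) ^ (h z i).toNat) * ((Real.sqrt k) ^ d)⁻¹ := by
    intro z
    simp_rw [div_pow, Finset.prod_div_distrib, Finset.prod_pow_eq_pow_sum, hdeg, div_eq_mul_inv]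
  have h2 : (∏ i, Real.sqrt (k.choose (r i) / 2 ^ k)) ^ 2 =
      (∏ i, (k.choose (r i) : ℝ)) / 2 ^ (k * n) := by
    rw [← Finset.prod_pow]
    simp_rw [Real.sq_sqrt (div_nonneg (Nat.cast_nonneg (α := ℝ) _) (pow_nonneg zero_le_two k)),
      Finset.prod_div_distrib]
    simp [pow_mul]
  have h3 : ((Real.sqrt k) ^ d) ^ 2 = (k : ℝ) ^ d := by
    rw [← pow_mul, mul_comm, pow_mul, Real.sq_sqrt hk'.le]
  simp_rw [h1, ← Finset.sum_mul, orbitSize_sub_two_mul (Fin.is_le _)]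
  rw [mul_pow, mul_pow, h2, mul_pow, inv_pow, inv_pow, Real.sq_sqrt (Nat.cast_nonneg _), h3]
  push_cast
  field_simp

/-! ### Operators on a subset of the qubits -/

section Lift

variable {ι ι' ι'' : Type*} [Fintype ι] [DecidableEq ι] [Fintype ι'] [DecidableEq ι']
  [Fintype ι''] [DecidableEq ι'']

open Classical in
/-- The operator that acts as `A` on the qubits in the range of `g` and trivially on the others. -/
noncomputable def liftOperator (g : ι' ↪ ι) (A : Matrix (ι' → Bool) (ι' → Bool) ℂ) :
    Matrix (ι → Bool) (ι → Bool) ℂ :=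
  Matrix.of fun x y => if ∀ q, q ∉ Set.range g → x q = y q then A (x ∘ g) (y ∘ g) else 0

open Classical in
/-- A vector on the qubits in the range of `g`, next to the basis state `y` on the others. -/
noncomputable def liftVector (g : ι' ↪ ι) (y : ι → Bool) :
    ((ι' → Bool) → ℂ) →ₗ[ℂ] ((ι → Bool) → ℂ) where
  toFun v x := if ∀ q, q ∉ Set.range g → x q = y q then v (x ∘ g) else 0
  map_add' v w := by funext x; simp only [Pi.add_apply]; split_ifs <;> simp
  map_smul' c v := by funext x; simp

theorem mulVec_ket (A : Matrix (ι → Bool) (ι → Bool) ℂ) (y x : ι → Bool) :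
    (A *ᵥ ket y) x = A x y := by
  rw [ket, Matrix.mulVec_single_one, Matrix.col_apply]

theorem mulVec_ket_eq_sum (A : Matrix (ι → Bool) (ι → Bool) ℂ) (y : ι → Bool) :
    A *ᵥ ket y = ∑ x, A x y • ket x := by
  funext x
  simp [ket, Pi.single_apply]

theorem ext_of_mulVec_ket {A B : Matrix (ι → Bool) (ι → Bool) ℂ}
    (h : ∀ y, A *ᵥ ket y = B *ᵥ ket y) : A = B := by
  ext x y
  rw [← mulVec_ket A, h, mulVec_ket]

omit [Fintype ι] [DecidableEq ι] [Fintype ι'] [DecidableEq ι'] in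
theorem eq_extend_iff (g : ι' ↪ ι) (u : ι' → Bool) (x y : ι → Bool) :
    x = Function.extend g u y ↔ (∀ q, q ∉ Set.range g → x q = y q) ∧ x ∘ g = u := by
  constructor
  · rintro rfl
    exact ⟨fun q hq => Function.extend_apply' _ _ _ hq,
      funext fun q => g.injective.extend_apply _ _ _⟩
  · rintro ⟨h1, rfl⟩
    funext q
    by_cases hq : q ∈ Set.range g
    · obtain ⟨q, rfl⟩ := hq
      rw [g.injective.extend_apply, Function.comp_apply]
    · rw [Function.extend_apply' _ _ _ hq, h1 q hq]

omit [DecidableEq ι'] in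
theorem liftVector_ket (g : ι' ↪ ι) (y : ι → Bool) (u : ι' → Bool) :
    liftVector g y (ket u) = ket (Function.extend g u y) := by
  funext x
  simp only [liftVector, ket, LinearMap.coe_mk, AddHom.coe_mk, Pi.single_apply, eq_extend_iff,
    ite_and]

omit [DecidableEq ι'] in
theorem liftVector_extend (g : ι' ↪ ι) (y : ι → Bool) (u : ι' → Bool) :
    liftVector g (Function.extend g u y) = liftVector g y := by
  refine LinearMap.ext fun v => funext fun x => ?_
  have : (∀ q, q ∉ Set.range g → x q = Function.extend g u y q) ↔
      ∀ q, q ∉ Set.range g → x q = y q :=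
    forall₂_congr fun q hq => by rw [Function.extend_apply' _ _ _ hq]
  simp only [liftVector, LinearMap.coe_mk, AddHom.coe_mk, this]

theorem liftOperator_mulVec_ket (g : ι' ↪ ι) (A : Matrix (ι' → Bool) (ι' → Bool) ℂ)
    (y : ι → Bool) : liftOperator g A *ᵥ ket y = liftVector g y (A *ᵥ ket (y ∘ g)) := by
  funext x
  rw [mulVec_ket]
  simp only [liftOperator, liftVector, Matrix.of_apply, LinearMap.coe_mk, AddHom.coe_mk, mulVec_ket]

omit [Fintype ι] [DecidableEq ι] [Fintype ι'] [DecidableEq ι'] in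
theorem extend_comp_self (g : ι' ↪ ι) (u : ι' → Bool) (y : ι → Bool) :
    Function.extend g u y ∘ g = u :=
  ((eq_extend_iff g u _ y).1 rfl).2

theorem liftOperator_mul (g : ι' ↪ ι) (A B : Matrix (ι' → Bool) (ι' → Bool) ℂ) :
    liftOperator g (A * B) = liftOperator g A * liftOperator g B := by
  refine ext_of_mulVec_ket fun y => ?_
  rw [← Matrix.mulVec_mulVec, liftOperator_mulVec_ket, liftOperator_mulVec_ket,
    ← Matrix.mulVec_mulVec, mulVec_ket_eq_sum B]
  simp_rw [Matrix.mulVec_sum, Matrix.mulVec_smul, map_sum, map_smul, Matrix.mulVec_sum,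
    Matrix.mulVec_smul, liftVector_ket, liftOperator_mulVec_ket, extend_comp_self,
    liftVector_extend]

theorem liftOperator_one (g : ι' ↪ ι) :
    liftOperator g (1 : Matrix (ι' → Bool) (ι' → Bool) ℂ) = 1 := by
  refine ext_of_mulVec_ket fun y => ?_
  rw [liftOperator_mulVec_ket, Matrix.one_mulVec, Matrix.one_mulVec, liftVector_ket]
  congr 1
  exact ((eq_extend_iff g _ y y).2 ⟨fun _ _ => rfl, rfl⟩).symm

omit [DecidableEq ι''] in
theorem liftOperator_liftOperator (g : ι' ↪ ι) (e : ι'' ↪ ι')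
    (A : Matrix (ι'' → Bool) (ι'' → Bool) ℂ) :
    liftOperator g (liftOperator e A) = liftOperator (e.trans g) A := by
  ext x y
  simp only [liftOperator, Matrix.of_apply, ← ite_and]
  refine if_congr ?_ rfl rfl
  constructor
  · rintro ⟨h1, h2⟩ q hq
    by_cases hg : q ∈ Set.range g
    · obtain ⟨q, rfl⟩ := hg
      refine h2 q fun ⟨p, hp⟩ => hq ⟨p, by simp [hp]⟩
    · exact h1 q hg
  · refine fun h => ⟨fun q hq => h q fun ⟨p, hp⟩ => hq ⟨e p, hp⟩, fun q hq => h (g q) ?_⟩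
    rintro ⟨p, hp⟩
    exact hq ⟨p, g.injective hp⟩

/-! ### Local decompositions -/

theorem isLocalUnitary_iff {b : ℕ} {A : Matrix (ι → Bool) (ι → Bool) ℂ} :
    IsLocalUnitary b A ↔ ∃ c ≤ b, ∃ e : Fin c ↪ ι,
      ∃ U ∈ Matrix.unitaryGroup (Fin c → Bool) ℂ, A = liftOperator e U := Iff.rfl

theorem IsLocalUnitary.mono {b b' : ℕ} (hb : b ≤ b') {A : Matrix (ι → Bool) (ι → Bool) ℂ}
    (h : IsLocalUnitary b A) : IsLocalUnitary b' A := by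
  obtain ⟨c, hc, h⟩ := h
  exact ⟨c, hc.trans hb, h⟩

theorem IsLocalUnitary.lift {b : ℕ} (g : ι' ↪ ι) {A : Matrix (ι' → Bool) (ι' → Bool) ℂ}
    (h : IsLocalUnitary b A) : IsLocalUnitary b (liftOperator g A) := by
  obtain ⟨c, hc, e, U, hU, rfl⟩ := isLocalUnitary_iff.1 h
  exact isLocalUnitary_iff.2 ⟨c, hc, e.trans g, U, hU, liftOperator_liftOperator g e U⟩

theorem isLocalUnitary_of_card_le {b : ℕ} {A : Matrix (ι → Bool) (ι → Bool) ℂ}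
    (hA : A ∈ Matrix.unitaryGroup (ι → Bool) ℂ) (hb : Fintype.card ι ≤ b) : IsLocalUnitary b A := by
  let σ := Fintype.equivFin ι
  let τ : (Fin (Fintype.card ι) → Bool) ≃ (ι → Bool) := σ.symm.arrowCongr (Equiv.refl Bool)
  refine isLocalUnitary_iff.2 ⟨_, hb, σ.symm.toEmbedding, A.submatrix τ τ, ?_, ?_⟩
  · rw [Matrix.mem_unitaryGroup_iff, Matrix.star_eq_conjTranspose] at hA ⊢
    rw [Matrix.conjTranspose_submatrix, Matrix.submatrix_mul_equiv, hA, Matrix.submatrix_one_equiv]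
  · ext x y
    have hτ : ∀ x : ι → Bool, τ (x ∘ σ.symm) = x := by
      intro x
      funext q
      simp [τ, Equiv.arrowCongr]
    simp [liftOperator, hτ]

theorem HasLocalDecomposition.mono {b b' s s' : ℕ} (hb : b ≤ b') (hs : s ≤ s')
    {A : Matrix (ι → Bool) (ι → Bool) ℂ} (h : HasLocalDecomposition b s A) :
    HasLocalDecomposition b' s' A := by
  obtain ⟨l, h1, h2, h3⟩ := h
  exact ⟨l, h1.trans hs, fun B hB => (h2 B hB).mono hb, h3⟩

theorem IsLocalUnitary.hasLocalDecomposition {b : ℕ} {A : Matrix (ι → Bool) (ι → Bool) ℂ}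
    (h : IsLocalUnitary b A) : HasLocalDecomposition b 1 A :=
  ⟨[A], by simp, by simpa using h, by simp⟩

theorem hasLocalDecomposition_one (b : ℕ) :
    HasLocalDecomposition b 0 (1 : Matrix (ι → Bool) (ι → Bool) ℂ) :=
  ⟨[], by simp, by simp, by simp⟩

theorem HasLocalDecomposition.mul {b s t : ℕ} {A B : Matrix (ι → Bool) (ι → Bool) ℂ}
    (hA : HasLocalDecomposition b s A) (hB : HasLocalDecomposition b t B) :
    HasLocalDecomposition b (s + t) (A * B) := by
  obtain ⟨l, h1, h2, rfl⟩ := hA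
  obtain ⟨l', h1', h2', rfl⟩ := hB
  refine ⟨l ++ l', by simpa using Nat.add_le_add h1 h1', fun C hC => ?_, by simp⟩
  exact (List.mem_append.1 hC).elim (h2 C) (h2' C)

theorem HasLocalDecomposition.lift {b s : ℕ} (g : ι' ↪ ι) {A : Matrix (ι' → Bool) (ι' → Bool) ℂ}
    (h : HasLocalDecomposition b s A) : HasLocalDecomposition b s (liftOperator g A) := by
  obtain ⟨l, h1, h2, rfl⟩ := h
  refine ⟨l.map (liftOperator g), by simpa using h1, ?_, ?_⟩
  · intro B hB
    obtain ⟨A, hA, rfl⟩ := List.mem_map.1 hB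
    exact (h2 A hA).lift g
  · clear h1 h2
    induction l with
    | nil => simp [liftOperator_one]
    | cons A l ih => simp [ih, liftOperator_mul]

end Lift

/-! ### The tensor power of the transform -/

section Tensor

/-- The tensor product of matrices `V i`, acting on `n` qudits. -/
def tensorProduct {κ : Type*} {n : ℕ} (V : Fin n → Matrix κ κ ℂ) :
    Matrix (Fin n → κ) (Fin n → κ) ℂ :=
  Matrix.of fun r s => ∏ i, V i (r i) (s i)

theorem tensorProduct_mul {κ : Type*} [Fintype κ] {n : ℕ} (V W : Fin n → Matrix κ κ ℂ) :
    tensorProduct V * tensorProduct W = tensorProduct fun i => V i * W i := by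
  ext r s
  simp only [tensorProduct, Matrix.mul_apply, Matrix.of_apply, ← Finset.prod_mul_distrib]
  exact sum_prod_eq_prod_sum fun i u => V i (r i) u * W i u (s i)

theorem tensorProduct_one {κ : Type*} [DecidableEq κ] {n : ℕ} :
    tensorProduct (fun _ : Fin n => (1 : Matrix κ κ ℂ)) = 1 := by
  ext r s
  simp only [tensorProduct, Matrix.of_apply, Matrix.one_apply, Finset.prod_ite_zero,
    Finset.prod_const_one, funext_iff, Finset.mem_univ, true_imp_iff]

theorem tensorProduct_update_one_apply {κ : Type*} [DecidableEq κ] {n : ℕ}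
    (i : Fin n) (V : Matrix κ κ ℂ) (r s : Fin n → κ) :
    tensorProduct (Function.update (fun _ => 1) i V) r s =
      if Function.update s i (r i) = r then V (r i) (s i) else 0 := by
  simp only [tensorProduct, Matrix.of_apply]
  rw [← Finset.mul_prod_erase _ _ (Finset.mem_univ i), Function.update_self,
    Finset.prod_congr rfl fun j hj => by rw [Function.update_of_ne (Finset.ne_of_mem_erase hj)]]
  simp only [Matrix.one_apply, Finset.prod_ite_zero, Finset.prod_const_one]
  rw [mul_ite, mul_one, mul_zero]
  refine if_congr ?_ rfl rfl
  rw [Function.update_eq_iff]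
  simp [eq_comm]

variable {ι κ : Type*} [Fintype ι] [DecidableEq ι] [Fintype κ]

theorem Implements.mul {E : κ → ι → Bool} {V W : Matrix κ κ ℂ}
    {A B : Matrix (ι → Bool) (ι → Bool) ℂ} (hA : Implements E V A) (hB : Implements E W B) :
    Implements E (V * W) (A * B) := by
  intro j
  rw [← Matrix.mulVec_mulVec, hB j, Matrix.mulVec_sum]
  simp_rw [Matrix.mulVec_smul, hA _, Matrix.mul_apply, Finset.smul_sum, Finset.sum_smul, smul_smul]
  rw [Finset.sum_comm]
  simp_rw [mul_comm]

theorem implements_one [DecidableEq κ] (E : κ → ι → Bool) :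
    Implements E 1 (1 : Matrix (ι → Bool) (ι → Bool) ℂ) := by
  intro j
  simp [Matrix.one_apply]

/-- The qubits of the `i`-th register and the first `a₀` ancilla qubits. -/
def registerEmbedding (n k : ℕ) {a₀ a : ℕ} (ha : a₀ ≤ a) (i : Fin n) :
    Fin k.size ⊕ Fin a₀ ↪ (Fin n × Fin k.size) ⊕ Fin a where
  toFun := Sum.map (fun q => (i, q)) (Fin.castLE ha)
  inj' := Sum.map_injective.2 ⟨fun _ _ h => (Prod.ext_iff.1 h).2, Fin.castLE_injective ha⟩

theorem encodeQudits_comp_registerEmbedding {n k a₀ a : ℕ} (ha : a₀ ≤ a) (i : Fin n)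
    (r : Fin n → Fin (k + 1)) :
    encodeQudits n k a r ∘ registerEmbedding n k ha i = encodeQudit k a₀ (r i) := by
  funext q
  rcases q with q | q <;> rfl

theorem extend_registerEmbedding {n k a₀ a : ℕ} (ha : a₀ ≤ a) (i : Fin n)
    (r : Fin n → Fin (k + 1)) (j : Fin (k + 1)) :
    Function.extend (registerEmbedding n k ha i) (encodeQudit k a₀ j) (encodeQudits n k a r) =
      encodeQudits n k a (Function.update r i j) := by
  symm
  rw [eq_extend_iff, encodeQudits_comp_registerEmbedding, Function.update_self]
  refine ⟨?_, rfl⟩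
  rintro (⟨i', q⟩ | q) hq
  · have : i' ≠ i := by
      rintro rfl
      exact hq ⟨Sum.inl q, rfl⟩
    simp [encodeQudits, Function.update_of_ne this]
  · rfl

/-- On an encoded state the lifted circuit sees only the code of `r i`, and it returns encoded
states that differ from `r` at most in the `i`-th level. -/
theorem implements_liftOperator {n k a₀ a : ℕ} (ha : a₀ ≤ a) (i : Fin n)
    {V : Matrix (Fin (k + 1)) (Fin (k + 1)) ℂ}
    {A : Matrix (Fin k.size ⊕ Fin a₀ → Bool) (Fin k.size ⊕ Fin a₀ → Bool) ℂ}
    (hA : Implements (encodeQudit k a₀) V A) :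
    Implements (encodeQudits n k a) (tensorProduct (Function.update (fun _ => 1) i V))
      (liftOperator (registerEmbedding n k ha i) A) := by
  intro r
  rw [liftOperator_mulVec_ket, encodeQudits_comp_registerEmbedding, hA, map_sum]
  simp_rw [map_smul, liftVector_ket, extend_registerEmbedding, tensorProduct_update_one_apply,
    ite_smul, zero_smul]
  rw [← Finset.sum_filter]
  refine Finset.sum_bij (fun j _ => Function.update r i j) ?_ ?_ ?_ ?_
  · simp
  · intro j _ j' _ h
    exact Function.update_injective r i h
  · intro s hs
    exact ⟨s i, Finset.mem_univ _, (Finset.mem_filter.1 hs).2⟩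
  · simp

/-- The registers are treated one at a time. Each run returns its ancillas to `0`, so all registers
can share the same `a₀` of them. -/
theorem exists_implements_tensorPower {n k a₀ a b s : ℕ} (ha : a₀ ≤ a)
    {V : Matrix (Fin (k + 1)) (Fin (k + 1)) ℂ}
    {A : Matrix (Fin k.size ⊕ Fin a₀ → Bool) (Fin k.size ⊕ Fin a₀ → Bool) ℂ}
    (hA : Implements (encodeQudit k a₀) V A) (hs : HasLocalDecomposition b s A) :
    ∃ W, HasLocalDecomposition b (n * s) W ∧
      Implements (encodeQudits n k a) (tensorPower n V) W := by
  have key : ∀ S : Finset (Fin n), ∃ W, HasLocalDecomposition b (S.card * s) W ∧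
      Implements (encodeQudits n k a) (tensorProduct fun i => if i ∈ S then V else 1) W := by
    intro S
    induction S using Finset.induction_on with
    | empty =>
      refine ⟨1, by simpa using hasLocalDecomposition_one b, ?_⟩
      simpa [tensorProduct_one] using implements_one (encodeQudits n k a)
    | insert i S hi ih =>
      obtain ⟨W, hW1, hW2⟩ := ih
      refine ⟨liftOperator (registerEmbedding n k ha i) A * W, ?_, ?_⟩
      · rw [Finset.card_insert_of_notMem hi, add_mul, one_mul, add_comm]
        exact (hs.lift _).mul hW1
      · have := (implements_liftOperator ha i hA).mul hW2
        rw [tensorProduct_mul] at this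
        convert this using 3 with j
        by_cases hj : j = i
        · subst hj
          simp [hi]
        · simp [hj]
  obtain ⟨W, hW1, hW2⟩ := key Finset.univ
  have : (tensorProduct fun i : Fin n => if i ∈ Finset.univ then V else 1) = tensorPower n V := by
    simp only [Finset.mem_univ, if_true]
    rfl
  exact ⟨W, by simpa using hW1, this ▸ hW2⟩

end Tensor

/-! ### Reversible evaluation of Boolean circuits -/

section Reversible

variable {ι : Type*} [Fintype ι] [DecidableEq ι]

theorem exists_unitary_of_involutive {κ : Type*} [Fintype κ] [DecidableEq κ] {σ : κ → κ}
    (hσ : Function.Involutive σ) :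
    (Matrix.of fun x y => if x = σ y then 1 else 0 : Matrix κ κ ℂ) ∈ Matrix.unitaryGroup κ ℂ := by
  rw [Matrix.mem_unitaryGroup_iff', Matrix.star_eq_conjTranspose]
  ext x y
  simp [Matrix.mul_apply, Matrix.one_apply, hσ.injective.eq_iff, eq_comm]

/-- `F` is computed on the basis states by a product of at most `s` local unitaries. -/
def IsReversible (s : ℕ) (F : (ι → Bool) → ι → Bool) : Prop :=
  ∃ A, HasLocalDecomposition 3 s A ∧ ∀ x, A *ᵥ ket x = ket (F x)

theorem isReversible_id : IsReversible 0 (id : (ι → Bool) → ι → Bool) :=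
  ⟨1, hasLocalDecomposition_one 3, fun x => by simp⟩

theorem IsReversible.comp {s t : ℕ} {F G : (ι → Bool) → ι → Bool} (hF : IsReversible s F)
    (hG : IsReversible t G) : IsReversible (s + t) (F ∘ G) := by
  obtain ⟨A, hA, hA'⟩ := hF
  obtain ⟨B, hB, hB'⟩ := hG
  exact ⟨A * B, hA.mul hB, fun x => by
    rw [← Matrix.mulVec_mulVec, hB', hA', Function.comp_apply]⟩

/-- Add the bit `f x` to the qubit `t`. -/
def xorMap (t : ι) (f : (ι → Bool) → Bool) (x : ι → Bool) : ι → Bool :=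
  Function.update x t (x t ^^ f x)

omit [Fintype ι] in
theorem xorMap_self (t : ι) (f : (ι → Bool) → Bool) (x : ι → Bool) :
    xorMap t f x t = (x t ^^ f x) := Function.update_self _ _ _

omit [Fintype ι] in
theorem xorMap_of_ne {t q : ι} (h : q ≠ t) (f : (ι → Bool) → Bool) (x : ι → Bool) :
    xorMap t f x q = x q := Function.update_of_ne h _ _

omit [Fintype ι] in
theorem xorMap_involutive {S : Finset ι} {t : ι} {f : (ι → Bool) → Bool} (ht : t ∉ S)
    (hf : ∀ x y, (∀ q ∈ S, x q = y q) → f x = f y) : Function.Involutive (xorMap t f) := by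
  intro x
  have h : f (xorMap t f x) = f x :=
    hf _ _ fun q hq => xorMap_of_ne (ne_of_mem_of_not_mem hq ht) _ _
  funext q
  by_cases hq : q = t
  · subst hq
    rw [xorMap_self, h, xorMap_self, Bool.xor_assoc, Bool.xor_self, Bool.xor_false]
  · rw [xorMap_of_ne hq, xorMap_of_ne hq]

/-- Since `f` does not read `t`, adding it twice cancels: the map is an involution living on at most
three qubits, hence a local permutation unitary. -/
theorem isReversible_xorMap {S : Finset ι} {t : ι} {f : (ι → Bool) → Bool} (ht : t ∉ S)
    (hS : S.card ≤ 2) (hf : ∀ x y, (∀ q ∈ S, x q = y q) → f x = f y) :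
    IsReversible 1 (xorMap t f) := by
  let g : ↥(insert t S) ↪ ι := Function.Embedding.subtype _
  -- `f` reads only `S`, so the qubits outside may be filled with `false`.
  let f' : (↥(insert t S) → Bool) → Bool := fun u => f (Function.extend g u fun _ => false)
  let t' : ↥(insert t S) := ⟨t, Finset.mem_insert_self t S⟩
  let S' : Finset ↥(insert t S) := Finset.univ.filter fun q => (q : ι) ∈ S
  have hσ : Function.Involutive (xorMap t' f') := by
    refine xorMap_involutive (S := S') (by simpa [S', t'] using ht) fun u v huv => hf _ _ ?_
    intro q hq
    have h1 := g.injective.extend_apply u (fun _ => false) ⟨q, Finset.mem_insert_of_mem hq⟩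
    have h2 := g.injective.extend_apply v (fun _ => false) ⟨q, Finset.mem_insert_of_mem hq⟩
    exact (h1.trans (huv _ (Finset.mem_filter.2 ⟨Finset.mem_univ _, hq⟩))).trans h2.symm
  have hcard : Fintype.card ↥(insert t S) ≤ 3 := by
    rw [Fintype.card_coe]
    exact (Finset.card_insert_le t S).trans (Nat.succ_le_succ hS)
  refine ⟨liftOperator g _, ((isLocalUnitary_of_card_le (exists_unitary_of_involutive hσ)
    hcard).lift g).hasLocalDecomposition, fun x => ?_⟩
  have h1 : (Matrix.of fun x y => if x = xorMap t' f' y then 1 else 0 :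
      Matrix (↥(insert t S) → Bool) (↥(insert t S) → Bool) ℂ) *ᵥ ket (x ∘ g) =
      ket (xorMap t' f' (x ∘ g)) := by
    funext u
    rw [mulVec_ket, Matrix.of_apply, ket, Pi.single_apply]
  rw [liftOperator_mulVec_ket, h1, liftVector_ket]
  congr 1
  symm
  rw [eq_extend_iff]
  have hfx : f' (x ∘ g) = f x := by
    refine hf _ _ fun q hq => ?_
    exact g.injective.extend_apply (x ∘ g) (fun _ => false) ⟨q, Finset.mem_insert_of_mem hq⟩
  constructor
  · intro q hq
    refine xorMap_of_ne ?_ f x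
    rintro rfl
    exact hq ⟨t', rfl⟩
  · funext q
    by_cases hq : q = t'
    · subst hq
      rw [Function.comp_apply, xorMap_self, hfx]
      exact xorMap_self t f x
    · rw [Function.comp_apply, xorMap_of_ne hq]
      exact xorMap_of_ne (fun h => hq (Subtype.ext h)) f x

/-- The bit on wire `i`, if there are `N` wires so far. -/
def readWire (wire : ℕ → ι) (N i : ℕ) (x : ι → Bool) : Bool := decide (i < N) && x (wire i)

/-- The qubits that are read for wire `i`. -/
def wireSupport (wire : ℕ → ι) (N i : ℕ) : Finset ι := if i < N then {wire i} else ∅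

omit [Fintype ι] [DecidableEq ι] in
theorem card_wireSupport_le (wire : ℕ → ι) (N i : ℕ) : (wireSupport wire N i).card ≤ 1 := by
  unfold wireSupport
  split_ifs <;> simp

omit [Fintype ι] [DecidableEq ι] in
theorem exists_of_mem_wireSupport {wire : ℕ → ι} {N i : ℕ} {q : ι}
    (h : q ∈ wireSupport wire N i) : ∃ w < N, q = wire w := by
  unfold wireSupport at h
  split_ifs at h with hi
  · exact ⟨i, hi, by simpa using h⟩
  · simp at h

omit [Fintype ι] [DecidableEq ι] in
theorem readWire_congr {wire : ℕ → ι} {N i : ℕ} {x y : ι → Bool}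
    (h : ∀ q ∈ wireSupport wire N i, x q = y q) : readWire wire N i x = readWire wire N i y := by
  unfold readWire
  by_cases hi : i < N
  · rw [h (wire i) (by simp [wireSupport, hi])]
  · simp [hi]

/-- One step of the evaluation of a Boolean circuit. -/
def appendGate (wires : List Bool) (g : ℕ × ℕ) : List Bool :=
  wires ++ [!(wires.getD g.1 false && wires.getD g.2 false)]

theorem length_foldl_appendGate (gates : List (ℕ × ℕ)) (l : List Bool) :
    (gates.foldl appendGate l).length = l.length + gates.length := by
  induction gates generalizing l with
  | nil => simp
  | cons g gates ih => simp [ih, appendGate]; omega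

/-- The gates of a Boolean circuit with `a` inputs can be applied reversibly to clean work qubits,
and they can be undone. -/
theorem exists_isReversible_gates (a : ℕ) (wire : ℕ → ι) (gates : List (ℕ × ℕ))
    (hwire : Set.InjOn wire (Set.Iio (a + gates.length))) :
    ∃ F F' : (ι → Bool) → ι → Bool,
      IsReversible gates.length F ∧ IsReversible gates.length F' ∧ Function.LeftInverse F' F ∧
      (∀ x v : ι → Bool, (∀ w < a + gates.length, v (wire w) = false) →
        F (fun q => x q ^^ v q) = fun q => F x q ^^ v q) ∧
      ∀ x : ι → Bool, (∀ s < gates.length, x (wire (a + s)) = false) →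
        (∀ q, (∀ s < gates.length, q ≠ wire (a + s)) → F x q = x q) ∧
        ∀ w < a + gates.length, F x (wire w) =
          (gates.foldl appendGate (List.ofFn fun i : Fin a => x (wire i))).getD w false := by
  induction gates using List.reverseRecOn with
  | nil =>
    refine ⟨id, id, isReversible_id, isReversible_id, fun _ => rfl, fun _ _ _ => rfl,
      fun x _ => ⟨fun _ _ => rfl, fun w hw => ?_⟩⟩
    have hw' : w < a := by simpa using hw
    simp [hw']
  | append_singleton gates g ih =>
    simp only [List.length_append, List.length_singleton] at hwire ⊢
    obtain ⟨F, F', hF, hF', hinv, hcomm, hval⟩ :=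
      ih (hwire.mono (Set.Iio_subset_Iio (by omega)))
    have hne : ∀ w < a + gates.length, wire w ≠ wire (a + gates.length) := by
      intro w hw h
      have := hwire (Set.mem_Iio.2 (by omega)) (Set.mem_Iio.2 (by omega)) h
      omega
    let N := a + gates.length
    -- An unwritten wire reads `false`, in agreement with the default of `getD` in
    -- `BoolCircuit.eval`.
    let f : (ι → Bool) → Bool := fun x => !(readWire wire N g.1 x && readWire wire N g.2 x)
    let S := wireSupport wire N g.1 ∪ wireSupport wire N g.2
    have hS : wire N ∉ S := by
      intro h
      rcases Finset.mem_union.1 h with h | h <;>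
      · obtain ⟨w, hw, h⟩ := exists_of_mem_wireSupport h
        exact hne w hw h.symm
    have hfS : ∀ x y, (∀ q ∈ S, x q = y q) → f x = f y := by
      intro x y h
      simp only [f]
      rw [readWire_congr fun q hq => h q (Finset.mem_union_left _ hq),
        readWire_congr fun q hq => h q (Finset.mem_union_right _ hq)]
    have hgate : IsReversible 1 (xorMap (wire N) f) :=
      isReversible_xorMap hS ((Finset.card_union_le _ _).trans (Nat.add_le_add
        (card_wireSupport_le _ _ _) (card_wireSupport_le _ _ _))) hfS
    refine ⟨xorMap (wire N) f ∘ F, F' ∘ xorMap (wire N) f, ?_, hF'.comp hgate, ?_, ?_, ?_⟩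
    · rw [add_comm]
      exact hgate.comp hF
    · intro x
      simp only [Function.comp_apply]
      rw [xorMap_involutive hS hfS, hinv]
    · intro x v hv
      simp only [Function.comp_apply]
      rw [hcomm x v fun w hw => hv w (by omega)]
      have hfv : f (fun q => F x q ^^ v q) = f (F x) := by
        refine hfS _ _ fun q hq => ?_
        obtain ⟨w, hw, rfl⟩ : ∃ w < N, q = wire w :=
          (Finset.mem_union.1 hq).elim exists_of_mem_wireSupport exists_of_mem_wireSupport
        rw [hv w (Nat.lt_succ_of_lt hw), Bool.xor_false]
      funext q
      by_cases hq : q = wire N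
      · subst hq
        rw [xorMap_self, xorMap_self, hfv, Bool.xor_assoc, Bool.xor_assoc, Bool.xor_comm (v _)]
      · rw [xorMap_of_ne hq, xorMap_of_ne hq]
    · intro x hx
      obtain ⟨h1, h2⟩ := hval x fun s hs => hx s (by omega)
      set l := gates.foldl appendGate (List.ofFn fun i : Fin a => x (wire i)) with hl
      have hlen : l.length = N := by rw [hl, length_foldl_appendGate, List.length_ofFn]
      have hread : ∀ i, readWire wire N i (F x) = l.getD i false := by
        intro i
        unfold readWire
        by_cases hi : i < N
        · simp only [hi, decide_true, Bool.true_and]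
          exact h2 i hi
        · rw [List.getD_eq_default _ _ (by omega)]
          simp [hi]
      refine ⟨fun q hq => ?_, fun w hw => ?_⟩
      · rw [Function.comp_apply, xorMap_of_ne (hq _ (Nat.lt_succ_self _)),
          h1 q fun s hs => hq s (Nat.lt_succ_of_lt hs)]
      · rw [Function.comp_apply, List.foldl_append, List.foldl_cons, List.foldl_nil, ← hl, appendGate]
        rcases Nat.lt_succ_iff_lt_or_eq.1 (show w < N + 1 from hw) with hw | rfl
        · rw [xorMap_of_ne (hne w hw), h2 w hw, List.getD_append _ _ _ _ (by omega)]
        -- The target is still clean, so adding the NAND to it writes the NAND.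
        · have h3 : F x (wire N) = false := by
            rw [h1 _ fun s hs h => ?_]
            · exact hx _ (Nat.lt_succ_self _)
            · exact hne (a + s) (by omega) h.symm
          rw [xorMap_self, h3, Bool.false_xor, List.getD_append_right _ _ _ _ hlen.le]
          simp only [f, hread, hlen]
          simp

open Classical in
/-- The bits `v j` with `j ∈ T`, on the qubits `out j`. -/
noncomputable def placeBits {b : ℕ} (out : Fin b → ι) (T : Finset (Fin b)) (v : Fin b → Bool) :
    ι → Bool :=
  fun q => decide (∃ j ∈ T, q = out j ∧ v j = true)

omit [Fintype ι] in
theorem placeBits_out {b : ℕ} {out : Fin b → ι} (hout : Function.Injective out)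
    (T : Finset (Fin b)) (v : Fin b → Bool) (j : Fin b) :
    placeBits out T v (out j) = (decide (j ∈ T) && v j) := by
  unfold placeBits
  by_cases hj : j ∈ T <;> cases hv : v j <;> simp [hj, hv, hout.eq_iff]

omit [Fintype ι] in
theorem placeBits_of_ne {b : ℕ} {out : Fin b → ι} {q : ι} (hq : ∀ j, q ≠ out j)
    (T : Finset (Fin b)) (v : Fin b → Bool) : placeBits out T v q = false := by
  simp [placeBits, hq]

/-- The copies land off the wires, so every further copy still reads the original values. -/
theorem isReversible_copy {b N : ℕ} {wire : ℕ → ι} {out : Fin b → ι}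
    (hout : Function.Injective out) (hdisj : ∀ j, ∀ w < N, out j ≠ wire w) (o : Fin b → ℕ)
    (T : Finset (Fin b)) :
    IsReversible T.card fun x : ι → Bool =>
      fun q => x q ^^ placeBits out T (fun j => readWire wire N (o j) x) q := by
  induction T using Finset.induction_on with
  | empty =>
    have : (fun (x : ι → Bool) q => x q ^^ placeBits out ∅ (fun j => readWire wire N (o j) x) q) =
        id := by
      funext x q
      simp [placeBits]
    rw [this]
    exact isReversible_id
  | insert j T hj ih =>
    have hmem : ∀ i, ∀ q ∈ wireSupport wire N i, ∀ j, q ≠ out j := by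
      intro i q hq j h
      obtain ⟨w, hw, rfl⟩ := exists_of_mem_wireSupport hq
      exact hdisj j w hw h.symm
    have hgate : IsReversible 1 (xorMap (out j) (readWire wire N (o j))) :=
      isReversible_xorMap (S := wireSupport wire N (o j)) (fun h => hmem _ _ h j rfl)
        ((card_wireSupport_le _ _ _).trans one_le_two) fun x y h => readWire_congr h
    rw [Finset.card_insert_of_notMem hj, add_comm]
    convert hgate.comp ih using 1
    funext x q
    rw [Function.comp_apply]
    by_cases hq : q = out j
    · subst hq
      rw [xorMap_self, placeBits_out hout, placeBits_out hout]
      have hread : readWire wire N (o j)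
          (fun q => x q ^^ placeBits out T (fun j => readWire wire N (o j) x) q) =
          readWire wire N (o j) x :=
        readWire_congr fun q hq => by rw [placeBits_of_ne (hmem _ q hq), Bool.xor_false]
      simp [hj, hread]
    · rw [xorMap_of_ne hq]
      congr 1
      simp [placeBits, hq]

/-- Compute, copy, uncompute: the output of a Boolean circuit is added to the qubits `out`, and the
work qubits are cleaned. -/
theorem BoolCircuit.exists_isReversible {a b : ℕ} (C : BoolCircuit a b) {wire : ℕ → ι}
    {out : Fin b → ι} (hwire : Set.InjOn wire (Set.Iio (a + C.size)))
    (hout : Function.Injective out) (hdisj : ∀ j, ∀ w < a + C.size, out j ≠ wire w) :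
    ∃ F, IsReversible (2 * C.size + b) F ∧
      ∀ x : ι → Bool, (∀ s < C.size, x (wire (a + s)) = false) →
        F x = fun q => x q ^^ placeBits out Finset.univ (C.eval fun i => x (wire i)) q := by
  obtain ⟨F, F', hF, hF', hinv, hcomm, hval⟩ := exists_isReversible_gates a wire C.gates hwire
  have hcopy := isReversible_copy hout hdisj C.output Finset.univ
  rw [Finset.card_univ, Fintype.card_fin] at hcopy
  have hrev := hF'.comp (hcopy.comp hF)
  refine ⟨F' ∘ (fun x q => x q ^^ placeBits out Finset.univ
      (fun j => readWire wire (a + C.size) (C.output j) x) q) ∘ F, ?_, fun x hx => ?_⟩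
  · convert hrev using 1
    unfold BoolCircuit.size
    omega
  · simp only [Function.comp_apply]
    have hread : (fun j => readWire wire (a + C.size) (C.output j) (F x)) =
        C.eval fun i => x (wire i) := by
      funext j
      unfold readWire BoolCircuit.eval
      by_cases hj : C.output j < a + C.size
      · simp only [hj, decide_true, Bool.true_and]
        exact (hval x hx).2 _ hj
      · have hlen := length_foldl_appendGate C.gates (List.ofFn fun i : Fin a => x (wire i))
        rw [List.length_ofFn] at hlen
        have := List.getD_eq_default (l := C.gates.foldl appendGate
          (List.ofFn fun i : Fin a => x (wire i))) (n := C.output j) (d := false)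
          (hlen ▸ Nat.le_of_not_lt hj)
        simp only [hj, decide_false, Bool.false_and]
        exact this.symm
    -- `F` commutes with adding bits off the wires, so the copied output passes through and `F'`
    -- undoes the computation.
    rw [hread, ← hcomm x _ fun w hw => placeBits_of_ne (fun j h => hdisj j w hw h.symm) _ _, hinv]

end Reversible

/-! ### The uniform superposition of an initial segment -/

section Superposition

/-- The normalized nonzero `v i` extend to an orthonormal basis, which gives the columns of `U`.
Multiplying by the norm instead of dividing keeps the formula valid for `v i = 0`, where the column
is arbitrary. -/
theorem exists_unitary_of_orthogonal {κ : Type*} [Fintype κ] [DecidableEq κ] (v : κ → κ → ℝ)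
    (hv : ∀ i j, i ≠ j → ∑ l, v i l * v j l = 0) :
    ∃ U ∈ Matrix.unitaryGroup κ ℂ, ∀ i l,
      ((Real.sqrt (∑ l, v i l ^ 2) : ℝ) : ℂ) * U l i = v i l := by
  let w : κ → EuclideanSpace ℂ κ := fun i => WithLp.toLp 2 fun l => (v i l : ℂ)
  have hinner : ∀ i j, inner ℂ (w i) (w j) = ((∑ l, v i l * v j l : ℝ) : ℂ) := by
    intro i j
    simp [w, PiLp.inner_apply, mul_comm]
  have hnorm : ∀ i, ‖w i‖ = Real.sqrt (∑ l, v i l ^ 2) := by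
    intro i
    simp [w, EuclideanSpace.norm_eq]
  let u : κ → EuclideanSpace ℂ κ := fun i => ((‖w i‖⁻¹ : ℝ) : ℂ) • w i
  have hu : Orthonormal ℂ (Set.domRestrict {i | w i ≠ 0} u) := by
    constructor
    · rintro ⟨i, hi⟩
      have : ‖w i‖ ≠ 0 := norm_ne_zero_iff.2 hi
      simp [u, Set.domRestrict_apply, norm_smul, this]
    · rintro ⟨i, hi⟩ ⟨j, hj⟩ hij
      have hij' : i ≠ j := fun h => hij (Subtype.ext h)
      simp [u, Set.domRestrict_apply, inner_smul_left, inner_smul_right, hinner, hv i j hij']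
  obtain ⟨b, hb⟩ := hu.exists_orthonormalBasis_extension_of_card_eq finrank_euclideanSpace
  refine ⟨_, OrthonormalBasis.toMatrix_orthonormalBasis_mem_unitary
    (EuclideanSpace.basisFun κ ℂ) b, fun i l => ?_⟩
  have hU : (EuclideanSpace.basisFun κ ℂ).toBasis.toMatrix b l i = b i l := by
    simp [Module.Basis.toMatrix_apply]
  rw [hU, ← hnorm]
  by_cases hi : w i = 0
  · have : (w i) l = 0 := by rw [hi]; rfl
    rw [hi, norm_zero, Complex.ofReal_zero, zero_mul]
    exact this.symm
  · rw [hb i hi]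
    have hne : (‖w i‖ : ℂ) ≠ 0 := by exact_mod_cast norm_ne_zero_iff.2 hi
    simp only [u, PiLp.smul_apply, smul_eq_mul, Complex.ofReal_inv]
    rw [mul_inv_cancel_left₀ hne]

/-- The number of `j < 2^t` with `j ≤ N mod 2^t` (for the flag `false`) or `j > N mod 2^t` (for the
flag `true`). -/
def segmentCount (N t : ℕ) (f : Bool) : ℕ := if f then 2 ^ t - 1 - N % 2 ^ t else N % 2 ^ t + 1

/-- The flag of a `(t+1)`-bit number with top bit `b` whose lower `t` bits have the flag `f`. -/
def nextFlag (N t : ℕ) (f b : Bool) : Bool := if b = N.testBit t then f else b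

theorem mod_two_pow_succ_eq (N t : ℕ) :
    N % 2 ^ (t + 1) = N % 2 ^ t + 2 ^ t * (N.testBit t).toNat := by
  rw [pow_succ, Nat.mod_mul, Nat.toNat_testBit]

/-- The top digit settles the comparison with `N` unless it equals that of `N`; then the lower
digits do. -/
theorem decide_lt_eq_nextFlag (N t j : ℕ) (hj : j < 2 ^ t) (b : Bool) :
    decide (N % 2 ^ (t + 1) < 2 ^ t * b.toNat + j) = nextFlag N t (decide (N % 2 ^ t < j)) b := by
  have h := Nat.mod_lt N (Nat.two_pow_pos t)
  rw [mod_two_pow_succ_eq, nextFlag]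
  cases b <;> cases N.testBit t <;> simp <;> omega

/-- The unnormalized action of the transition on the flag (qubit `false`) and the next bit
(qubit `true`). -/
noncomputable def transition (N t : ℕ) (u u' : Bool → Bool) : ℝ :=
  if u true = false ∧ u false = nextFlag N t (u' false) (u' true) then
    Real.sqrt (segmentCount N t (u' false)) else 0

/-- The output flag and digit determine the input flag, and the digit qubit must start clean, so
different inputs have disjoint supports. -/
theorem sum_transition_mul (N t : ℕ) (u v : Bool → Bool) (huv : u ≠ v) :
    ∑ l, transition N t u l * transition N t v l = 0 := by
  refine Finset.sum_eq_zero fun l _ => ?_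
  unfold transition
  split_ifs with h1 h2
  · refine absurd (funext fun q => ?_) huv
    cases q
    · rw [h1.2, h2.2]
    · rw [h1.1, h2.1]
  all_goals simp

theorem sum_boolArrow {M : Type*} [AddCommMonoid M] (F : (Bool → Bool) → M) :
    ∑ u, F u = ∑ f, ∑ b, F fun q => if q then b else f := by
  rw [← Fintype.sum_prod_type']
  refine Fintype.sum_equiv (Equiv.boolArrowEquivProd Bool) _ _ fun u => ?_
  congr 1
  funext q
  cases q <;> rfl

/-- Squared amplitudes count the completions by lower digits; adding them over the top digit counts
all numbers with the given flag. -/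
theorem sum_transition_sq (N t : ℕ) (u : Bool → Bool) (hu : u true = false) :
    ∑ l, transition N t u l ^ 2 = segmentCount N (t + 1) (u false) := by
  have h := Nat.mod_lt N (Nat.two_pow_pos t)
  have hsq : ∀ l, transition N t u l ^ 2 =
      ((if u false = nextFlag N t (l false) (l true) then segmentCount N t (l false)
        else 0 : ℕ) : ℝ) := by
    intro l
    unfold transition
    simp only [hu, true_and]
    split_ifs
    · rw [Real.sq_sqrt (Nat.cast_nonneg _)]
    · simp
  simp_rw [hsq, ← Nat.cast_sum]
  congr 1
  simp only [sum_boolArrow, Fintype.sum_bool, segmentCount, nextFlag, mod_two_pow_succ_eq,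
    if_true, Bool.false_eq_true, if_false]
  simp only [pow_succ]
  cases u false <;> cases N.testBit t <;> simp <;> omega

theorem sum_range_two_pow_succ {M : Type*} [AddCommMonoid M] (t : ℕ) (F : ℕ → M) :
    ∑ j ∈ Finset.range (2 ^ (t + 1)), F j =
      ∑ b : Bool, ∑ j ∈ Finset.range (2 ^ t), F (2 ^ t * b.toNat + j) := by
  rw [pow_succ, mul_two, Finset.sum_range_add, Fintype.sum_bool, add_comm]
  simp

variable {ι : Type*} [Fintype ι] [DecidableEq ι]

/-- Write the `t` low-order digits of `j` on the qubits `z 0, …, z (t-1)`. -/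
noncomputable def writeBits (z : ℕ → ι) (t j : ℕ) (x : ι → Bool) : ι → Bool :=
  Function.extend (fun i : Fin t => z i) (binary t j) x

omit [Fintype ι] [DecidableEq ι] in
theorem writeBits_of_ne {z : ℕ → ι} {t : ℕ} {q : ι} (hq : ∀ i < t, q ≠ z i) (j : ℕ)
    (x : ι → Bool) : writeBits z t j x q = x q :=
  Function.extend_apply' _ _ _ fun ⟨i, hi⟩ => hq i i.2 hi.symm

omit [Fintype ι] [DecidableEq ι] in
theorem writeBits_apply {z : ℕ → ι} {t : ℕ} (hz : Set.InjOn z (Set.Iio t)) {i : ℕ} (hi : i < t)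
    (j : ℕ) (x : ι → Bool) : writeBits z t j x (z i) = j.testBit i := by
  have hinj : Function.Injective fun i : Fin t => z i :=
    fun i i' h => Fin.ext (hz (Set.mem_Iio.2 i.2) (Set.mem_Iio.2 i'.2) h)
  exact hinj.extend_apply (binary t j) x ⟨i, hi⟩

/-- Each gate splits a branch by the square roots of the numbers of completions, so the amplitudes
telescope to uniform ones. The norm stays on the left because the count may be `0`. With no digits
left, the flag `true` admits no number, which is why the flag ends in `false`. -/
theorem exists_uniform_superposition (N : ℕ) (z : ℕ → ι) (flag : ι) (t : ℕ)
    (hz : Set.InjOn z (Set.Iio t)) (hflag : ∀ i < t, flag ≠ z i) :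
    ∃ T, HasLocalDecomposition 3 t T ∧ ∀ x : ι → Bool, (∀ i < t, x (z i) = false) →
      ((Real.sqrt (segmentCount N t (x flag)) : ℝ) : ℂ) • T *ᵥ ket x =
        ∑ j ∈ Finset.range (2 ^ t), if x flag = decide (N % 2 ^ t < j) then
          ket (Function.update (writeBits z t j x) flag false) else 0 := by
  induction t with
  | zero =>
    refine ⟨1, hasLocalDecomposition_one 3, fun x _ => ?_⟩
    have hw : writeBits z 0 0 x = x := funext fun q => writeBits_of_ne (by simp) 0 x
    cases h : x flag
    · have hx : Function.update x flag false = x := by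
        rw [← h, Function.update_eq_self]
      simp [segmentCount, hw, hx, Nat.mod_one]
    · simp [segmentCount, Nat.mod_one]
  | succ t ih =>
    obtain ⟨T, hT, hT'⟩ := ih (hz.mono (Set.Iio_subset_Iio (Nat.le_succ t)))
      fun i hi => hflag i (Nat.lt_succ_of_lt hi)
    have hne : flag ≠ z t := hflag t (Nat.lt_succ_self t)
    have hzne : ∀ i < t, z i ≠ z t := fun i hi h =>
      hi.ne (hz (Set.mem_Iio.2 (by omega)) (Set.mem_Iio.2 (by omega)) h)
    let g : Bool ↪ ι := ⟨fun q => if q then z t else flag, by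
      intro q q' h
      cases q <;> cases q'
      exacts [rfl, absurd h hne, absurd h.symm hne, rfl]⟩
    obtain ⟨U, hU, hU'⟩ := exists_unitary_of_orthogonal (transition N t) (sum_transition_mul N t)
    -- The gate for the top digit acts first; `T` then writes the lower digits under the new flag.
    refine ⟨T * liftOperator g U, hT.mul ((isLocalUnitary_of_card_le hU
      (by simp)).lift g).hasLocalDecomposition, fun x hx => ?_⟩
    have hx1 : (x ∘ g) true = false := hx t (Nat.lt_succ_self t)
    have hx0 : (x ∘ g) false = x flag := rfl
    have hstep : ((Real.sqrt (segmentCount N (t + 1) (x flag)) : ℝ) : ℂ) •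
        (liftOperator g U *ᵥ ket x) =
        ∑ l, ((transition N t (x ∘ g) l : ℝ) : ℂ) • ket (Function.extend g l x) := by
      rw [liftOperator_mulVec_ket, mulVec_ket_eq_sum, map_sum, Finset.smul_sum]
      refine Finset.sum_congr rfl fun l _ => ?_
      rw [map_smul, liftVector_ket, smul_smul, ← hU', sum_transition_sq N t _ hx1, hx0]
    rw [← Matrix.mulVec_mulVec, ← Matrix.mulVec_smul, hstep, Matrix.mulVec_sum]
    have hl : ∀ l : Bool → Bool,
        T *ᵥ (((transition N t (x ∘ g) l : ℝ) : ℂ) • ket (Function.extend g l x)) =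
        ∑ j ∈ Finset.range (2 ^ t), if x flag = nextFlag N t (l false) (l true) ∧
            l false = decide (N % 2 ^ t < j) then
          ket (Function.update (writeBits z (t + 1) (2 ^ t * (l true).toNat + j) x) flag false)
          else 0 := by
      intro l
      have hlf : Function.extend g l x flag = l false := g.injective.extend_apply l x false
      have hlt : Function.extend g l x (z t) = l true := g.injective.extend_apply l x true
      have hlo : ∀ q, q ≠ flag → q ≠ z t → Function.extend g l x q = x q := by
        intro q h1 h2
        refine Function.extend_apply' _ _ _ ?_
        rintro ⟨c, rfl⟩
        cases c
        · exact h1 rfl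
        · exact h2 rfl
      have hih := hT' (Function.extend g l x) fun i hi => by
        rw [hlo _ (hflag i (Nat.lt_succ_of_lt hi)).symm (hzne i hi), hx i (Nat.lt_succ_of_lt hi)]
      rw [Matrix.mulVec_smul, transition, hx0]
      simp only [hx1, true_and]
      by_cases hn : x flag = nextFlag N t (l false) (l true)
      · simp only [hn, true_and, if_true]
        rw [hlf] at hih
        rw [hih]
        refine Finset.sum_congr rfl fun j hj => ?_
        have hj' := Finset.mem_range.1 hj
        congr 2
        funext q
        by_cases hq : q = flag
        · subst hq
          rw [Function.update_self, Function.update_self]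
        rw [Function.update_of_ne hq, Function.update_of_ne hq]
        by_cases hqz : ∃ i < t + 1, q = z i
        · obtain ⟨i, hi, rfl⟩ := hqz
          rw [writeBits_apply hz hi, Nat.testBit_two_pow_mul_add _ hj']
          rcases Nat.lt_succ_iff_lt_or_eq.1 hi with hi' | rfl
          · rw [writeBits_apply (hz.mono (Set.Iio_subset_Iio (Nat.le_succ t))) hi', if_pos hi']
          · rw [writeBits_of_ne (fun i' hi' => (hzne i' hi').symm), hlt, if_neg (lt_irrefl _),
              Nat.sub_self]
            cases l true <;> simp
        · push Not at hqz
          rw [writeBits_of_ne hqz, writeBits_of_ne fun i hi => hqz i (Nat.lt_succ_of_lt hi),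
            hlo q hq (hqz t (Nat.lt_succ_self t))]
      · simp [hn]
    simp_rw [hl]
    rw [sum_boolArrow, sum_range_two_pow_succ, Finset.sum_comm]
    refine Finset.sum_congr rfl fun b _ => ?_
    rw [Finset.sum_comm]
    refine Finset.sum_congr rfl fun j hj => ?_
    rw [decide_lt_eq_nextFlag N t j (Finset.mem_range.1 hj)]
    simp only [if_true, Bool.false_eq_true, if_false]
    -- The intermediate flag is determined by `j`, so the sum over it has a single term.
    simp_rw [and_comm (b := _ = decide _), ite_and, Finset.sum_ite_eq', Finset.mem_univ, if_true]

end Superposition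

/-! ### Preparation of the monomial state -/

section Preparation

variable {n m k a : ℕ}

/-- The `w`-th ancilla qubit. -/
def ancilla (n k : ℕ) {a : ℕ} (ha : 0 < a) (w : ℕ) : (Fin n × Fin k.size) ⊕ Fin a :=
  Sum.inr (if h : w < a then ⟨w, h⟩ else ⟨0, ha⟩)

theorem ancilla_injOn (n k : ℕ) (ha : 0 < a) : Set.InjOn (ancilla n k ha) (Set.Iio a) := by
  intro w hw w' hw' h
  rw [ancilla, ancilla, dif_pos (Set.mem_Iio.1 hw), dif_pos (Set.mem_Iio.1 hw'), Sum.inr.injEq,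
    Fin.mk.injEq] at h
  exact h

/-- The lowest qubit of the `i`-th register. -/
def lowQubit (hk : 0 < k) (a : ℕ) (i : Fin n) : (Fin n × Fin k.size) ⊕ Fin a :=
  Sum.inl (i, ⟨0, Nat.size_pos.2 hk⟩)

theorem lowQubit_injective (hk : 0 < k) (a : ℕ) : Function.Injective (lowQubit (n := n) hk a) := by
  intro i j h
  simpa [lowQubit] using h

theorem lowQubit_ne_ancilla (hk : 0 < k) (ha : 0 < a) (i : Fin n) (w : ℕ) :
    lowQubit hk a i ≠ ancilla n k ha w := Sum.inl_ne_inr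

/-- A bit occupies only the lowest qubit of its register, so Boolean outputs can be added directly
into the registers. -/
theorem encodeQudits_bitLevel (hk : 0 < k) (u : Fin n → Bool) :
    encodeQudits n k a (fun i => bitLevel hk (u i)) =
      placeBits (lowQubit hk a) Finset.univ u := by
  funext q
  by_cases hq : ∃ i, q = lowQubit hk a i
  · obtain ⟨i, rfl⟩ := hq
    rw [placeBits_out (lowQubit_injective hk a)]
    cases h : u i <;> simp [encodeQudits, lowQubit, binary, bitLevel, h]
  · push Not at hq
    rw [placeBits_of_ne hq]
    rcases q with ⟨i, q⟩ | q
    · have hq0 : (q : ℕ) ≠ 0 := fun h0 => hq i (by simp [lowQubit, Fin.ext_iff, h0])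
      cases h : u i <;> simp [encodeQudits, binary, bitLevel, h,
        Nat.testBit_lt_two_pow (Nat.one_lt_two_pow hq0)]
    · rfl

theorem sum_monomialState_smul {M : Type*} [AddCommGroup M] [Module ℂ M] (hk : 0 < k)
    (h : Fin m → Fin n → Bool) (F : (Fin n → Fin (k + 1)) → M) :
    ∑ r, monomialState k h r • F r =
      (((Real.sqrt m)⁻¹ : ℝ) : ℂ) • ∑ z, F fun i => bitLevel hk (h z i) := by
  rw [monomialState_eq hk]
  simp_rw [Pi.smul_apply, Finset.sum_apply, smul_assoc, Finset.sum_smul]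
  rw [← Finset.smul_sum, Finset.sum_comm]
  simp [Pi.single_apply]

theorem exists_uniform_state {ι : Type*} [Fintype ι] [DecidableEq ι] (hm : 0 < m)
    (hmn : m ≤ 2 ^ n) (z : ℕ → ι) (flag : ι) (hz : Set.InjOn z (Set.Iio n))
    (hflag : ∀ i < n, flag ≠ z i) :
    ∃ T, HasLocalDecomposition 3 n T ∧
      T *ᵥ ket (fun _ => false) = (((Real.sqrt m)⁻¹ : ℝ) : ℂ) •
        ∑ j : Fin m, ket (writeBits z n j fun _ => false) := by
  -- The flag `false` selects `j ≤ N`, so `N = m - 1` yields exactly the `j < m`.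
  obtain ⟨T, hT, hT'⟩ := exists_uniform_superposition (m - 1) z flag n hz hflag
  refine ⟨T, hT, ?_⟩
  have h := hT' (fun _ => false) fun _ _ => rfl
  have hmod : (m - 1) % 2 ^ n = m - 1 := Nat.mod_eq_of_lt (by omega)
  have hcount : segmentCount (m - 1) n false = m := by
    simp only [segmentCount, hmod, Bool.false_eq_true, if_false]
    omega
  have hupd : ∀ j, Function.update (writeBits z n j fun _ => false) flag false =
      writeBits z n j fun _ => false := by
    intro j
    rw [Function.update_eq_self_iff, writeBits_of_ne hflag]
  have hsum : (∑ j ∈ Finset.range (2 ^ n), if false = decide ((m - 1) % 2 ^ n < j) then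
      ket (Function.update (writeBits z n j fun _ => false) flag false) else 0) =
      ∑ j : Fin m, ket (writeBits z n j fun _ => false) := by
    simp_rw [hupd, hmod]
    rw [Fin.sum_univ_eq_sum_range fun j => ket (writeBits z n j fun _ => false),
      ← Finset.sum_filter]
    congr 1
    ext j
    simp only [Finset.mem_filter, Finset.mem_range, eq_comm (a := false), decide_eq_false_iff_not]
    omega
  rw [hsum, hcount] at h
  have hne : ((Real.sqrt m : ℝ) : ℂ) ≠ 0 :=
    Complex.ofReal_ne_zero.2 (Real.sqrt_ne_zero'.2 (by exact_mod_cast hm))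
  rw [← h, smul_smul, Complex.ofReal_inv, inv_mul_cancel₀ hne, one_smul]

/-- From the superposition of `|z, 0⟩`, the circuit `C` leads to `|z, h(z)⟩`, and adding the output
`z` of `C'` to the index leaves `|0, h(z)⟩`. The first `n` ancillas hold the index, work qubits
start at ancilla `n`, and the flag lies beyond them. -/
theorem exists_preparation (hk : 0 < k) (hm : 0 < m) {h : Fin m → Fin n → Bool}
    (hinj : Function.Injective h) (C C' : BoolCircuit n n)
    (hC : ∀ z : Fin m, C.eval (binary n z) = h z) (hC' : ∀ z : Fin m, C'.eval (h z) = binary n z)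
    (ha : n + C.size + C'.size < a) :
    ∃ P, HasLocalDecomposition 3 (3 * n + 2 * C.size + 2 * C'.size) P ∧
      P *ᵥ ket (fun _ => false) = ∑ r, monomialState k h r • ket (encodeQudits n k a r) := by
  have ha0 : 0 < a := by omega
  let anc := ancilla n k ha0
  have hanc : ∀ N ≤ a, Set.InjOn anc (Set.Iio N) := fun N hN =>
    (ancilla_injOn n k ha0).mono (Set.Iio_subset_Iio hN)
  have hmn : m ≤ 2 ^ n := by
    simpa using Fintype.card_le_of_injective h hinj
  let low := lowQubit (n := n) hk a
  let index : Fin n → (Fin n × Fin k.size) ⊕ Fin a := fun i => anc i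
  have hindex : Function.Injective index := fun i j hij =>
    Fin.ext (hanc n (by omega) (Set.mem_Iio.2 i.2) (Set.mem_Iio.2 j.2) hij)
  -- `C'` takes its inputs from the registers; its work qubits start at ancilla `n` too, since `C`
  -- leaves its own clean.
  let wire : ℕ → (Fin n × Fin k.size) ⊕ Fin a := fun w => if h : w < n then low ⟨w, h⟩ else anc w
  have hwire : Set.InjOn wire (Set.Iio (n + C'.size)) := by
    intro w hw w' hw' hww
    simp only [wire] at hww
    split_ifs at hww with h1 h2 h2
    · simpa using lowQubit_injective hk a hww
    · exact absurd hww (lowQubit_ne_ancilla hk ha0 _ _)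
    · exact absurd hww.symm (lowQubit_ne_ancilla hk ha0 _ _)
    · exact hanc (n + C'.size) (by omega) hw hw' hww
  have hwire_index : ∀ i, ∀ w < n + C'.size, index i ≠ wire w := by
    intro i w hw hiw
    simp only [wire, index] at hiw
    split_ifs at hiw with h1
    · exact lowQubit_ne_ancilla hk ha0 _ _ hiw.symm
    · have := hanc (n + C'.size) (by omega) (Set.mem_Iio.2 (by omega)) hw hiw
      omega
  obtain ⟨T, hT, hT'⟩ := exists_uniform_state hm hmn anc (anc (n + C.size + C'.size))
    (hanc n (by omega)) fun i hi heq => by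
      have := hanc a le_rfl (Set.mem_Iio.2 ha) (Set.mem_Iio.2 (by omega)) heq
      omega
  obtain ⟨F, ⟨A, hA, hA'⟩, hF⟩ := C.exists_isReversible (hanc _ (by omega))
    (lowQubit_injective hk a) fun i w _ => lowQubit_ne_ancilla hk ha0 i w
  obtain ⟨F', ⟨B, hB, hB'⟩, hF'⟩ := C'.exists_isReversible hwire hindex hwire_index
  refine ⟨B * (A * T), (hB.mul (hA.mul hT)).mono le_rfl (by omega), ?_⟩
  rw [sum_monomialState_smul hk h fun r => ket (encodeQudits n k a r), ← Matrix.mulVec_mulVec,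
    ← Matrix.mulVec_mulVec, hT', Matrix.mulVec_smul, Matrix.mulVec_smul, Matrix.mulVec_sum,
    Matrix.mulVec_sum]
  congr 1
  refine Finset.sum_congr rfl fun z _ => ?_
  rw [hA', hB', encodeQudits_bitLevel]
  congr 1
  set x := writeBits anc n (z : ℕ) fun _ => false with hx
  have hx_index : ∀ i < n, x (anc i) = (z : ℕ).testBit i := fun i hi =>
    writeBits_apply (hanc n (by omega)) hi _ _
  have hx_ne : ∀ q, (∀ i < n, q ≠ anc i) → x q = false := fun q hq => writeBits_of_ne hq _ _
  have hx_work : ∀ w, n ≤ w → w < a → x (anc w) = false := fun w hw hwa => hx_ne _ fun i hi heq => by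
    have := hanc a le_rfl (Set.mem_Iio.2 hwa) (Set.mem_Iio.2 (by omega)) heq
    omega
  have hxF : F x = fun q => x q ^^ placeBits low Finset.univ (h z) q := by
    have hin : (fun i : Fin n => x (anc i)) = binary n z := funext fun i => hx_index i i.2
    rw [hF x fun s hs => hx_work _ (by omega) (by omega), hin, hC z]
  have hanc_low : ∀ w, placeBits low Finset.univ (h z) (anc w) = false := fun w =>
    placeBits_of_ne (fun j hj => lowQubit_ne_ancilla hk ha0 j w hj.symm) _ _
  have hFlow : (fun i : Fin n => F x (wire i)) = h z := by
    funext i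
    have hwi : wire i = low i := dif_pos i.2
    rw [hxF, hwi]
    simp only
    rw [placeBits_out (lowQubit_injective hk a),
      hx_ne _ fun j _ => lowQubit_ne_ancilla hk ha0 i j]
    simp
  have hFwork : ∀ s < C'.size, F x (wire (n + s)) = false := by
    intro s hs
    have hws : wire (n + s) = anc (n + s) := dif_neg (by omega)
    rw [hxF, hws]
    simp only
    rw [hanc_low, hx_work _ (by omega) (by omega), Bool.xor_false]
  rw [hF' _ hFwork, hFlow, hC' z, hxF]
  funext q
  simp only
  by_cases hq : ∃ i : Fin n, q = index i
  · obtain ⟨i, rfl⟩ := hq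
    rw [placeBits_out hindex, hanc_low, hx_index i i.2]
    simp [binary]
  · push Not at hq
    rw [placeBits_of_ne hq, hx_ne q fun i hi => hq ⟨i, hi⟩, Bool.false_xor, Bool.xor_false]

end Preparation

/-! ### The measurement -/

section Measurement

variable {n k a : ℕ}

theorem outcome_encodeQudits (r : Fin n → Fin (k + 1)) :
    outcome n k a (encodeQudits n k a r) = fun i => (k : ℤ) - 2 * (r i : ℕ) := by
  funext i
  have h : Nat.ofBits (fun q : Fin k.size => encodeQudits n k a r (Sum.inl (i, q))) = (r i : ℕ) := by
    change Nat.ofBits (fun q : Fin k.size => (r i : ℕ).testBit q) = _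
    rw [Nat.ofBits_testBit]
    exact Nat.mod_eq_of_lt (lt_of_le_of_lt (r i).is_le (Nat.lt_size_self k))
  rw [outcome, h]

theorem eq_of_levels_eq {r s : Fin n → Fin (k + 1)}
    (h : (fun i => (k : ℤ) - 2 * (r i : ℕ)) = fun i => (k : ℤ) - 2 * (s i : ℕ)) : r = s := by
  funext i
  have := congrFun h i
  exact Fin.ext (by omega)

theorem encodeQudits_injective : Function.Injective (encodeQudits n k a) := by
  intro r s h
  refine eq_of_levels_eq ?_
  rw [← outcome_encodeQudits (a := a), h, outcome_encodeQudits]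

theorem squashedProb_eq_zero {Q : MvPolynomial (Fin n) ℝ} {y : Fin n → ℤ}
    (hy : ∀ r : Fin n → Fin (k + 1), (fun i => (k : ℤ) - 2 * (r i : ℕ)) ≠ y) :
    squashedProb k Q y = 0 := by
  have : ∃ i, orbitSize k (y i) = 0 := by
    by_contra! hne
    choose r hr using fun i => exists_of_orbitSize_ne_zero (hne i)
    exact hy r (funext hr)
  obtain ⟨i, hi⟩ := this
  rw [squashedProb, Finset.prod_eq_zero (Finset.mem_univ i) (by simp [hi])]
  simp

theorem mulVec_encoded_superposition {ι κ : Type*} [Fintype ι] [DecidableEq ι] [Fintype κ]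
    {E : κ → ι → Bool} {V : Matrix κ κ ℂ} {W : Matrix (ι → Bool) (ι → Bool) ℂ}
    (hW : Implements E V W) (c : κ → ℂ) :
    W *ᵥ ∑ j, c j • ket (E j) = ∑ i, (V *ᵥ c) i • ket (E i) := by
  simp_rw [Matrix.mulVec_sum, Matrix.mulVec_smul, hW _, Finset.smul_sum, smul_smul]
  rw [Finset.sum_comm]
  refine Finset.sum_congr rfl fun i _ => ?_
  rw [← Finset.sum_smul]
  simp_rw [Matrix.mulVec, dotProduct, mul_comm]

/-- Different codewords give different outcomes, so each outcome collects at most one amplitude;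
strings that are not codewords (a register may hold a number above `k`) have amplitude `0`. If `y`
is not of the form `k - 2r`, some orbit size vanishes and both sides are `0`. -/
theorem outcomeProb_eq {Q : MvPolynomial (Fin n) ℝ}
    {A : Matrix ((Fin n × Fin k.size) ⊕ Fin a → Bool) ((Fin n × Fin k.size) ⊕ Fin a → Bool) ℂ}
    {c : (Fin n → Fin (k + 1)) → ℂ}
    (hA : A *ᵥ ket (fun _ => false) = ∑ r, c r • ket (encodeQudits n k a r))
    (hc : ∀ r, ‖c r‖ ^ 2 = squashedProb k Q fun j => (k : ℤ) - 2 * (r j : ℕ)) (y : Fin n → ℤ) :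
    outcomeProb n k a A y = squashedProb k Q y := by
  have hval : ∀ r, (A *ᵥ ket fun _ => false) (encodeQudits n k a r) = c r := by
    intro r
    rw [hA]
    simp [ket, Pi.single_apply, encodeQudits_injective.eq_iff]
  have hzero : ∀ x, (∀ r, x ≠ encodeQudits n k a r) → (A *ᵥ ket fun _ => false) x = 0 := by
    intro x hx
    rw [hA]
    simp [ket, hx]
  unfold outcomeProb
  by_cases hy : ∃ r : Fin n → Fin (k + 1), (fun i => (k : ℤ) - 2 * (r i : ℕ)) = y
  · obtain ⟨r, rfl⟩ := hy
    rw [Finset.sum_eq_single (encodeQudits n k a r), hval, hc]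
    · intro x hx hne
      rw [hzero x, norm_zero, zero_pow two_ne_zero]
      rintro s rfl
      rw [Finset.mem_filter, outcome_encodeQudits] at hx
      exact hne (by rw [eq_of_levels_eq hx.2])
    · intro hx
      rw [Finset.mem_filter, outcome_encodeQudits] at hx
      exact absurd ⟨Finset.mem_univ _, rfl⟩ hx
  · push Not at hy
    rw [squashedProb_eq_zero hy]
    refine Finset.sum_eq_zero fun x hx => ?_
    rw [hzero x, norm_zero, zero_pow two_ne_zero]
    rintro s rfl
    rw [Finset.mem_filter, outcome_encodeQudits] at hx
    exact hy s hx.2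

end Measurement

theorem mainTheorem5 {I : Type*} (n m k d : I → ℕ)
    (Q : ∀ i, MvPolynomial (Fin (n i)) ℝ)
    (h : ∀ i, Fin (m i) → Fin (n i) → Bool)
    (hQ : ∀ i, IsSpecifiedBy (Q i) (h i))
    (hm : ∀ i, 0 < m i)
    (hd : ∀ i, 0 < d i)
    (hhom : ∀ i, (Q i).IsHomogeneous (d i))
    (hk : ∀ i, 0 < k i) :
    (∀ i, squashedQFT (k i) ∈ Matrix.unitaryGroup (Fin (k i + 1)) ℂ) ∧
    (∀ i (r : Fin (n i) → Fin (k i + 1)),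
      ‖(tensorPower (n i) (squashedQFT (k i)) *ᵥ monomialState (k i) (h i)) r‖ ^ 2 =
        squashedProb (k i) (Q i) (fun j => (k i : ℤ) - 2 * (r j : ℕ))) ∧
    (EfficientlyInvertible n m h →
      (∃ p : Polynomial ℕ, ∀ i, k i ≤ 2 ^ p.eval (n i)) →
      SquashedQFTEfficient n k →
      ∃ (b : ℕ) (p : Polynomial ℕ), ∀ i, ∃ a ≤ p.eval (n i),
        ∃ P W : Matrix ((Fin (n i) × Fin (k i).size) ⊕ Fin a → Bool)
            ((Fin (n i) × Fin (k i).size) ⊕ Fin a → Bool) ℂ,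
          HasLocalDecomposition b (p.eval (n i)) P ∧
          HasLocalDecomposition b (p.eval (n i)) W ∧
          P *ᵥ ket (fun _ => false) =
            ∑ r, monomialState (k i) (h i) r • ket (encodeQudits (n i) (k i) a r) ∧
          Implements (encodeQudits (n i) (k i) a)
            (tensorPower (n i) (squashedQFT (k i))) W ∧
          ∀ y : Fin (n i) → ℤ,
            outcomeProb (n i) (k i) a (W * P) y = squashedProb (k i) (Q i) y) := by
  refine ⟨fun i => squashedQFT_mem_unitaryGroup (k i),
    fun i r => norm_sq_amplitude (hQ i) (hhom i) (hd i) (hk i) r, ?_⟩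
  rintro ⟨pC, hC⟩ - ⟨b, pV, hV⟩
  -- One polynomial bounds the ancillas, the `n * pV` gates of `W` and the `3n + 2|C| + 2|C'|` gates
  -- of `P`.
  refine ⟨max b 3, pV + Polynomial.X * pV + 3 * Polynomial.X + 4 * pC + 1, fun i => ?_⟩
  obtain ⟨C, C', hCs, hCs', hCe, hCe'⟩ := hC i
  obtain ⟨a₀, ha₀, A, hA, hA'⟩ := hV i
  have heval : (pV + Polynomial.X * pV + 3 * Polynomial.X + 4 * pC + 1).eval (n i) =
      pV.eval (n i) + n i * pV.eval (n i) + 3 * n i + 4 * pC.eval (n i) + 1 := by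
    simp
  rw [heval]
  obtain ⟨P, hP, hP'⟩ := exists_preparation (a := a₀ + (n i + C.size + C'.size + 1)) (hk i) (hm i)
    (hQ i).1 C C' hCe hCe' (by omega)
  obtain ⟨W, hW, hW'⟩ := exists_implements_tensorPower (n := n i)
    (Nat.le_add_right a₀ (n i + C.size + C'.size + 1)) hA' hA
  refine ⟨a₀ + (n i + C.size + C'.size + 1), ?_, P, W, hP.mono (le_max_right _ _) ?_,
    hW.mono (le_max_left _ _) ?_, hP', hW', outcomeProb_eq (c := tensorPower (n i)
      (squashedQFT (k i)) *ᵥ monomialState (k i) (h i)) ?_ fun r =>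
        norm_sq_amplitude (hQ i) (hhom i) (hd i) (hk i) r⟩
  · omega
  · omega
  · omega
  · rw [← Matrix.mulVec_mulVec, hP', mulVec_encoded_superposition hW']
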